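/- A nondeterministic Turing machine $M=(Q,\Sigma,\Gamma,\delta,q_0,F)$ with a one-way read-only input and one read/write worktape has finite sets $Q$ of states, $\Sigma$ of input letters and $\Gamma$ of worktape symbols (with a blank), an initial state $q_0\in Q$, final states $F\subseteq Q$, and a transition relation $\delta$ from $Q\times(\Sigma\cup\{\lambda\})\times\Gamma$ to $Q\times\Gamma\times\{\mathrm L,\mathrm S,\mathrm R\}$: depending on the state and the scanned worktape symbol, $M$ reads an input letter or nothing ($\lambda$), changes the state, overwrites the scanned symbol and moves the worktape head one cell left, not at all, or one cell right. The worktape is infinite in both directions and initially blank. A word $w\in\Sigma^*$ is in $L(M)$ if some computation that starts in $q_0$ with input $w$ ends in a state of $F$ with the whole input read. For $k\ge 0$, $M$ is $k$-reversal-bounded if in every accepting computation the worktape head changes at most $k$ times between moving left and moving right (stationary steps being disregarded). A language $L\subseteq\Sigma^*$ is dense if every word of $\Sigma^*$ is an infix of a word of $L$, that is, $\inf(L)=\Sigma^*$, where $\inf(L)=\{y\mid xyz\in L \text{ for some } x,z\in\Sigma^*\}$. **Proposition.** It is decidable, given such a machine $M$ and a number $k$ such that $M$ is $k$-reversal-bounded,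 whether $L(M)$ is dense. That is, there is an algorithm which, on input a finite description of $M$ and a number $k$ for which $M$ is $k$-reversal-bounded, decides whether $\inf(L(M))=\Sigma^*$. -/

import Mathlib

/-- The infix closure of a language: all words `y` with `x ++ y ++ z ∈ L` for some `x`, `z`. -/
def Language.infixes {α : Type*} (L : Language α) : Language α :=
  {y | ∃ w ∈ L, y <:+: w}

/-- A language is dense if every word over the alphabet is an infix of one of its words. -/
def Language.IsDense {α : Type*} (L : Language α) : Prop :=
  L.infixes = (Set.univ : Set (List α))

/-- A nondeterministic Turing machine with a one-way read-only input over `α` and one bi-infinite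
read/write worktape over `Γ`; the blank is `default : Γ`. An element `((q, a, c), (q', d, m))` of
`trans` says: in state `q`, scanning `c` on the worktape, the machine may consume `a` from the
input (`none` consumes nothing), overwrite `c` by `d`, move the worktape head by `m`
(`none` means that the head stays) and enter `q'`. -/
structure NTM (Q α Γ : Type*) where
  trans : Set ((Q × Option α × Γ) × (Q × Γ × Option Turing.Dir))
  start : Q
  final : Set Q

namespace NTM

/-- A configuration: state, remaining input, and worktape with head position. -/
structure Cfg (Q α Γ : Type*) [Inhabited Γ] where
  state : Q
  input : List α
  tape : Turing.Tape Γ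

variable {Q α Γ : Type*} [Inhabited Γ]

/-- The effect of a head move (or stay) on a worktape. -/
def moveHead (m : Option Turing.Dir) (T : Turing.Tape Γ) : Turing.Tape Γ :=
  match m with
  | none => T
  | some d => T.move d

/-- One step of `M`, labelled by the move of the worktape head. -/
inductive Step (M : NTM Q α Γ) : Cfg Q α Γ → Option Turing.Dir → Cfg Q α Γ → Prop
  | mk {q q' : Q} {a : Option α} {d : Γ} {m : Option Turing.Dir} {T : Turing.Tape Γ}
      (h : ((q, a, T.head), (q', d, m)) ∈ M.trans) (w : List α) :
      Step M ⟨q, a.toList ++ w, T⟩ m ⟨q', w, moveHead m (T.write d)⟩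

/-- `M.Run C ms C'`: there is a computation of `M` from `C` to `C'` whose successive steps
move the worktape head as listed in `ms`. -/
inductive Run (M : NTM Q α Γ) : Cfg Q α Γ → List (Option Turing.Dir) → Cfg Q α Γ → Prop
  | refl (C : Cfg Q α Γ) : Run M C [] C
  | cons {C C' C'' : Cfg Q α Γ} {m : Option Turing.Dir} {ms : List (Option Turing.Dir)} :
      Step M C m C' → Run M C' ms C'' → Run M C (m :: ms) C''

/-- The initial configuration on input `w`: start state and an all-blank worktape. -/
def init (M : NTM Q α Γ) (w : List α) : Cfg Q α Γ :=
  ⟨M.start, w, default⟩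

/-- A configuration is accepting if its state is final and the input is exhausted. -/
def Accepting (M : NTM Q α Γ) (C : Cfg Q α Γ) : Prop :=
  C.state ∈ M.final ∧ C.input = []

/-- The language accepted by `M`. -/
def language (M : NTM Q α Γ) : Language α :=
  {w | ∃ ms C, M.Run (M.init w) ms C ∧ M.Accepting C}

/-- The number of changes between moving left and moving right in a sequence of head moves;
steps in which the head stays are disregarded. -/
def reversals (ms : List (Option Turing.Dir)) : ℕ :=
  (ms.reduceOption.zip ms.reduceOption.tail).countP fun p => p.1 ≠ p.2

/-- `M` is `k`-reversal-bounded: every accepting computation makes at most `k` reversals. -/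
def IsReversalBounded (M : NTM Q α Γ) (k : ℕ) : Prop :=
  ∀ w ms C, M.Run (M.init w) ms C → M.Accepting C → reversals ms ≤ k

end NTM

/-- A finite description of a machine by natural numbers: the sizes of the state set, the input
alphabet and the worktape alphabet, the numbers of the blank and of the start state, the list of
final states, and the list of transitions, where a head move is `none` (stay), `some false` (left)
or `some true` (right). -/
structure NTMCode where
  numStates : ℕ
  numLetters : ℕ
  numSymbols : ℕ
  blank : ℕ
  start : ℕ
  final : List ℕ
  trans : List ((ℕ × Option ℕ × ℕ) × (ℕ × ℕ × Option Bool))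

namespace NTMCode

/-- A description is the tuple of its entries. -/
def equivProd : NTMCode ≃
    ℕ × ℕ × ℕ × ℕ × ℕ × List ℕ × List ((ℕ × Option ℕ × ℕ) × (ℕ × ℕ × Option Bool)) where
  toFun c := (c.numStates, c.numLetters, c.numSymbols, c.blank, c.start, c.final, c.trans)
  invFun t := ⟨t.1, t.2.1, t.2.2.1, t.2.2.2.1, t.2.2.2.2.1, t.2.2.2.2.2.1, t.2.2.2.2.2.2⟩
  left_inv _ := rfl
  right_inv _ := rfl

instance : Primcodable NTMCode := Primcodable.ofEquiv _ equivProd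

/-- The code of a direction. -/
def dirBit : Turing.Dir → Bool
  | Turing.Dir.left => false
  | Turing.Dir.right => true

/-- `c` describes `M`: for some numberings of the states, of the input letters and of the worktape
symbols of `M`, the entries of `c` are the corresponding components of `M`. -/
def Describes {Q α Γ : Type*} [Inhabited Γ] (c : NTMCode) (M : NTM Q α Γ) : Prop :=
  ∃ (eQ : Q ≃ Fin c.numStates) (eα : α ≃ Fin c.numLetters) (eΓ : Γ ≃ Fin c.numSymbols),
    (eΓ default : ℕ) = c.blank ∧
    (eQ M.start : ℕ) = c.start ∧
    (∀ q, q ∈ M.final ↔ (eQ q : ℕ) ∈ c.final) ∧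
    ∀ q a x q' y m, ((q, a, x), (q', y, m)) ∈ M.trans ↔
      (((eQ q : ℕ), a.map (fun b => (eα b : ℕ)), (eΓ x : ℕ)),
        ((eQ q' : ℕ), (eΓ y : ℕ), m.map dirBit)) ∈ c.trans

/-- Every machine with finitely many states, letters and symbols has a description. -/
theorem exists_describes {Q α Γ : Type*} [Inhabited Γ] [Finite Q] [Finite α] [Finite Γ]
    (M : NTM Q α Γ) : ∃ c : NTMCode, c.Describes M := by
  classical
  have : Finite Turing.Dir :=
    Finite.of_injective dirBit (by intro a b h; cases a <;> cases b <;> simp_all [dirBit])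
  have hd : Function.Injective dirBit := by
    intro a b h; cases a <;> cases b <;> simp_all [dirBit]
  obtain ⟨n, ⟨eQ⟩⟩ := Finite.exists_equiv_fin Q
  obtain ⟨l, ⟨eα⟩⟩ := Finite.exists_equiv_fin α
  obtain ⟨s, ⟨eΓ⟩⟩ := Finite.exists_equiv_fin Γ
  let g : ((Q × Option α × Γ) × (Q × Γ × Option Turing.Dir)) →
      ((ℕ × Option ℕ × ℕ) × (ℕ × ℕ × Option Bool)) := fun t =>
    (((eQ t.1.1 : ℕ), t.1.2.1.map (fun b => (eα b : ℕ)), (eΓ t.1.2.2 : ℕ)),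
      ((eQ t.2.1 : ℕ), (eΓ t.2.2.1 : ℕ), t.2.2.2.map dirBit))
  have hg : Function.Injective g := by
    rintro ⟨⟨q, a, x⟩, q', y, m⟩ ⟨⟨p, b, z⟩, p', u, k⟩ h
    simp only [g, Prod.mk.injEq, Fin.val_inj, eQ.injective.eq_iff, eΓ.injective.eq_iff] at h
    obtain ⟨⟨h1, h2, h3⟩, h4, h5, h6⟩ := h
    have h2' := Option.map_injective (Fin.val_injective.comp eα.injective) h2
    have h6' := Option.map_injective hd h6
    subst h1 h2' h3 h4 h5 h6'
    rfl
  refine ⟨⟨n, l, s, eΓ default, eQ M.start,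
    ((fun q => (eQ q : ℕ)) '' M.final).toFinite.toFinset.toList,
    (g '' M.trans).toFinite.toFinset.toList⟩, eQ, eα, eΓ, rfl, rfl, ?_, ?_⟩
  · intro q
    simp [Fin.val_inj]
  · intro q a x q' y m
    rw [Finset.mem_toList, Set.Finite.mem_toFinset]
    exact (hg.mem_set_image (a := ((q, a, x), (q', y, m)))).symm

end NTMCode

/-!
Why density is decidable. A computation with at most `k` reversals consists of `K = k + 2` sweeps,
during each of which the head moves in one direction only, the directions alternating and the first
sweep, possibly empty, going to the right (`NTM.Run.exists_sweeps`). If the language is dense, then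
for every word `y` the power `y ^ K` is an infix of an accepted word, and since the `K` sweeps leave
only `K - 1` seams in the input, one copy of `y` is read in a single sweep
(`NTM.readInSweep_of_infix`). So the language is dense if and only if every word is a factor of what
some sweep of some accepting computation reads.

The words read in one sweep form a regular language. Write the worktape contents between the sweeps,
with the state at the head position, as `K + 1` words of equal length, one below the other. Each
sweep relates two consecutive words, and a finite automaton checks this relation cell by cell, as
the sweep passes every cell only once (`NTM.Sweep.exists_costPath`, `NTM.exists_sweep_of_costPath`).
Sweeps against the direction of inspection are checked backwards. Running the `K` automata side by
side on the columns of the array, and following one distinguished sweep step by step, gives a finite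
graph with labelled and silent edges whose path labels are the words read in that sweep
(`NTM.exists_epsPath_of_costPath`, `NTM.exists_costPath_of_epsPath`).

The number of nodes of this graph is bounded by an explicit function of the numbers of states and
worktape symbols and of `k`. By the subset construction it reads all words if it reads all words up
to a certain length (`EpsPath.universal_of_short`), and by cutting out cycles a word that is read in
one sweep is read in one sweep of a short computation (`EpsPath.shorten`). Hence density is
equivalent to a statement that quantifies over words and computations of bounded length
(`NTM.isDense_iff`), which is primitive recursive in the description of the machine and `k`
(`NTMCode.primrecPred_boundedDense`). The promise that the machine is `k`-reversal-bounded is needed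
only for the equivalence; the search is defined for all descriptions.
-/

/-! ### Labelled graphs with silent edges -/

/-- `EpsPath E x y n z`: in the graph with edge relation `E`, whose edges carry a letter or are
silent (`none`), there is a path of `n` edges from `x` to `z` whose label is the word `y`. -/
inductive EpsPath {X α : Type*} (E : X → Option α → X → Prop) : X → List α → ℕ → X → Prop
  | nil (x : X) : EpsPath E x [] 0 x
  | cons {x x' z : X} {a : Option α} {y : List α} {n : ℕ} :
      E x a x' → EpsPath E x' y n z → EpsPath E x (a.toList ++ y) (n + 1) z

namespace EpsPath

variable {X α : Type*} {E : X → Option α → X → Prop}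

theorem single {x z : X} {a : Option α} (h : E x a z) : EpsPath E x a.toList 1 z := by
  simpa using EpsPath.cons h (.nil z)

theorem append {x y z : X} {u v : List α} {m n : ℕ} (h₁ : EpsPath E x u m y)
    (h₂ : EpsPath E y v n z) : EpsPath E x (u ++ v) (m + n) z := by
  induction h₁ with
  | nil x => simpa using h₂
  | cons he _ ih =>
    rw [List.append_assoc, Nat.add_right_comm]
    exact .cons he (ih h₂)

theorem split {x z : X} {u v : List α} {n : ℕ} (h : EpsPath E x (u ++ v) n z) :
    ∃ y n₁ n₂, EpsPath E x u n₁ y ∧ EpsPath E y v n₂ z := by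
  generalize hw : u ++ v = w at h
  induction h generalizing u with
  | nil x =>
    obtain ⟨rfl, rfl⟩ := List.append_eq_nil_iff.1 hw
    exact ⟨x, 0, 0, .nil x, .nil x⟩
  | @cons x x' z a w n he hp ih =>
    rcases a with _ | a
    · obtain ⟨y, n₁, n₂, h₁, h₂⟩ := ih (u := u) (by simpa using hw)
      exact ⟨y, n₁ + 1, n₂, by simpa using EpsPath.cons he h₁, h₂⟩
    · rcases u with _ | ⟨b, u⟩
      · subst hw
        exact ⟨x, 0, n + 1, .nil x, .cons he hp⟩
      · simp only [Option.toList_some, List.cons_append, List.nil_append, List.cons.injEq] at hw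
        obtain ⟨rfl, hw⟩ := hw
        obtain ⟨y, n₁, n₂, h₁, h₂⟩ := ih (u := u) hw
        exact ⟨y, n₁ + 1, n₂, by simpa using EpsPath.cons he h₁, h₂⟩

theorem split_at {x z : X} {y : List α} {n : ℕ} (h : EpsPath E x y n z) :
    ∀ i ≤ n, ∃ w u v, y = u ++ v ∧ EpsPath E x u i w ∧ EpsPath E w v (n - i) z := by
  induction h with
  | nil x =>
    intro i hi
    obtain rfl : i = 0 := by omega
    exact ⟨x, [], [], rfl, .nil x, .nil x⟩
  | @cons x x' z a y n he hp ih =>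
    intro i hi
    rcases i with _ | i
    · exact ⟨x, [], _, rfl, .nil x, .cons he hp⟩
    · obtain ⟨w, u, v, rfl, h₁, h₂⟩ := ih i (by omega)
      refine ⟨w, a.toList ++ u, v, by simp, .cons he h₁, ?_⟩
      rwa [Nat.add_sub_add_right]

/-- Cutting out cycles: the positions along a path with label `y` may be told apart by the node
and the length of the label read so far. -/
theorem shorten [Finite X] {x z : X} {y : List α} {n : ℕ} (h : EpsPath E x y n z) :
    ∃ m ≤ Nat.card X * (y.length + 1), EpsPath E x y m z := by
  induction n using Nat.strong_induction_on with
  | _ n ih =>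
  by_cases hn : n ≤ Nat.card X * (y.length + 1)
  · exact ⟨n, hn, h⟩
  have hs := h.split_at
  have : Nonempty X := ⟨x⟩
  choose! w u v hy h₁ h₂ using hs
  have : ¬ Function.Injective (fun i : Fin (n + 1) =>
      ((w i, ⟨(u i).length, by
        have := congrArg List.length (hy i (by omega))
        simp only [List.length_append] at this
        omega⟩) : X × Fin (y.length + 1))) := by
    intro hinj
    have := Nat.card_le_card_of_injective _ hinj
    simp only [Nat.card_prod, Nat.card_fin] at this
    omega
  simp only [Function.Injective, not_forall] at this
  obtain ⟨i, j, hij, hne⟩ := this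
  wlog hlt : i < j generalizing i j
  · exact this j i hij.symm (Ne.symm hne) (lt_of_le_of_ne (not_lt.1 hlt) (Ne.symm hne))
  simp only [Prod.mk.injEq, Fin.mk.injEq] at hij
  have hi : (i : ℕ) ≤ n := by omega
  have hj : (j : ℕ) ≤ n := by omega
  have huv := (hy i hi).symm.trans (hy j hj)
  have hu : u i = u j := (List.append_inj huv hij.2).1
  have hp := (h₁ i hi).append (hij.1 ▸ h₂ j hj)
  rw [hu, ← hy j hj] at hp
  have hlt' : (i : ℕ) < j := hlt
  exact ih _ (by omega) hp

/-- If only the existence of a path matters and not its label, fewer edges suffice. -/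
theorem shorten_unlabelled [Finite X] {x z : X} {y : List α} {n : ℕ} (h : EpsPath E x y n z) :
    ∃ m ≤ Nat.card X, ∃ y', EpsPath E x y' m z := by
  let E' : X → Option α → X → Prop := fun x a z => a = none ∧ ∃ b, E x b z
  have h' : EpsPath E' x [] n z := by
    induction h with
    | nil x => exact .nil x
    | cons he _ ih => exact EpsPath.cons (a := none) ⟨rfl, _, he⟩ ih
  obtain ⟨m, hm, hp⟩ := h'.shorten
  refine ⟨m, by simpa using hm, ?_⟩
  clear hm h h'
  generalize ([] : List α) = w at hp
  induction hp with
  | nil x => exact ⟨[], .nil x⟩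
  | cons he _ ih =>
    obtain ⟨y', hy'⟩ := ih
    obtain ⟨_, b, hb⟩ := he
    exact ⟨_, .cons hb hy'⟩

/-- A finite graph with silent edges is a nondeterministic automaton. If it reads every word that
is shorter than the number of sets of nodes, then it reads every word, by the subset
construction. -/
theorem universal_of_short [Finite X] (I F : Set X)
    (h : ∀ y : List α, y.length ≤ 2 ^ Nat.card X →
      ∃ x ∈ I, ∃ z ∈ F, ∃ n, EpsPath E x y n z) (y : List α) :
    ∃ x ∈ I, ∃ z ∈ F, ∃ n, EpsPath E x y n z := by
  classical
  have := Fintype.ofFinite X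
  let D : DFA α (Set X) :=
    { step := fun S a => {z | ∃ x ∈ S, ∃ n, EpsPath E x [a] n z}
      start := {z | ∃ x ∈ I, ∃ n, EpsPath E x [] n z}
      accept := {S | ∃ z ∈ F, z ∈ S} }
  have hD : ∀ y, D.eval y = {z | ∃ x ∈ I, ∃ n, EpsPath E x y n z} := by
    intro y
    induction y using List.reverseRecOn with
    | nil => rfl
    | append_singleton y a ih =>
      rw [DFA.eval_append_singleton, ih]
      ext z
      constructor
      · rintro ⟨w, ⟨x, hx, n, hn⟩, m, hm⟩
        exact ⟨x, hx, _, hn.append hm⟩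
      · rintro ⟨x, hx, n, hn⟩
        obtain ⟨w, n₁, n₂, h₁, h₂⟩ := hn.split
        exact ⟨w, ⟨x, hx, _, h₁⟩, _, h₂⟩
  generalize hl : y.length = l
  induction l using Nat.strong_induction_on generalizing y with
  | _ l ih =>
  by_cases hle : y.length ≤ 2 ^ Nat.card X
  · exact h y hle
  obtain ⟨q, a, b, c, rfl, -, hb, h₁, h₂, h₃⟩ := D.evalFrom_split (s := D.start) (x := y)
    (t := D.eval y) (by rw [Fintype.card_set, ← Nat.card_eq_fintype_card]; omega) rfl
  have hac : D.eval (a ++ c) = D.eval (a ++ b ++ c) := by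
    rw [← h₃, DFA.eval, DFA.evalFrom_of_append, h₁]
  have hb' : 0 < b.length := List.length_pos_iff.2 hb
  obtain ⟨x, hx, z, hz, n, hn⟩ := ih _ (by simp at hl ⊢; omega) (a ++ c) rfl
  have hmem : z ∈ D.eval (a ++ c) := by rw [hD]; exact ⟨x, hx, n, hn⟩
  rw [hac, hD] at hmem
  obtain ⟨x', hx', m, hm⟩ := hmem
  exact ⟨x', hx', z, hz, m, hm⟩

end EpsPath

/-! ### Paths that consume a list -/

/-- `ListPath R s cs s'`: the list `cs` can be processed from left to right, starting in the state
`s` and ending in `s'`, where each element is processed as `R` allows. -/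
inductive ListPath {S C : Type*} (R : S → C → S → Prop) : S → List C → S → Prop
  | nil (s : S) : ListPath R s [] s
  | cons {s s' s'' : S} {c : C} {cs : List C} :
      R s c s' → ListPath R s' cs s'' → ListPath R s (c :: cs) s''

namespace ListPath

variable {S C : Type*} {R : S → C → S → Prop}

theorem append {s s' s'' : S} {cs ds : List C} (h₁ : ListPath R s cs s')
    (h₂ : ListPath R s' ds s'') : ListPath R s (cs ++ ds) s'' := by
  induction h₁ with
  | nil s => exact h₂
  | cons h _ ih => exact .cons h (ih h₂)

theorem reverse {s s' : S} {cs : List C} (h : ListPath R s cs s') :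
    ListPath (fun a c b => R b c a) s' cs.reverse s := by
  induction h with
  | nil s => exact .nil s
  | cons h _ ih =>
    rw [List.reverse_cons]
    exact ih.append (.cons h (.nil _))

theorem mono {R' : S → C → S → Prop} (hR : ∀ s c s', R s c s' → R' s c s') {s s' : S}
    {cs : List C} (h : ListPath R s cs s') : ListPath R' s cs s' := by
  induction h with
  | nil s => exact .nil s
  | cons h _ ih => exact .cons (hR _ _ _ h) ih

end ListPath

/-- `CostPath R s cs u n s'`: like `ListPath`, where moreover processing an element reads a word
and has a cost; `u` is the concatenation of these words and `n` the sum of the costs. -/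
inductive CostPath {S C α : Type*} (R : S → C → List α → ℕ → S → Prop) :
    S → List C → List α → ℕ → S → Prop
  | nil (s : S) : CostPath R s [] [] 0 s
  | cons {s s' s'' : S} {c : C} {cs : List C} {u v : List α} {m n : ℕ} :
      R s c u m s' → CostPath R s' cs v n s'' → CostPath R s (c :: cs) (u ++ v) (m + n) s''

namespace CostPath

variable {S C α : Type*} {R : S → C → List α → ℕ → S → Prop}

theorem toListPath {R' : S → C → S → Prop} (hR : ∀ s c u n s', R s c u n s' → R' s c s')
    {s s' : S} {cs : List C} {u : List α} {n : ℕ} (h : CostPath R s cs u n s') :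
    ListPath R' s cs s' := by
  induction h with
  | nil s => exact .nil s
  | cons h _ ih => exact .cons (hR _ _ _ _ _ h) ih

theorem of_listPath {b : ℕ} {s s' : S} {cs : List C}
    (h : ListPath (fun s c s' => ∃ u, ∃ n ≤ b, R s c u n s') s cs s') :
    ∃ u, ∃ n ≤ b * cs.length, CostPath R s cs u n s' := by
  induction h with
  | nil s => exact ⟨[], 0, by simp, .nil s⟩
  | cons h _ ih =>
    obtain ⟨u, n, hn, h⟩ := h
    obtain ⟨v, m, hm, ih⟩ := ih
    exact ⟨u ++ v, n + m, by rw [List.length_cons, mul_add, mul_one]; omega, .cons h ih⟩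

end CostPath

/-! ### Repeated words as infixes of a concatenation -/

/-- If `l` consecutive copies of `y` are an infix of a concatenation of `l` words, then one of the
copies lies inside one of these words: there are fewer seams than copies. -/
theorem List.exists_infix_of_flatten_replicate_infix {α : Type*} (y : List α) :
    ∀ ws : List (List α), ws ≠ [] → (List.replicate ws.length y).flatten <:+: ws.flatten →
      ∃ w ∈ ws, y <:+: w
  | [], h, _ => absurd rfl h
  | [w], _, h => ⟨w, by simp, by simpa using h⟩
  | w :: w' :: ws, _, h => by
    obtain ⟨p, s, h⟩ := h
    set W := (w' :: ws).flatten with hW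
    set Y := (List.replicate (w' :: ws).length y).flatten with hY
    have h : (p ++ y) ++ (Y ++ s) = w ++ W := by
      rw [List.length_cons, List.replicate_succ, List.flatten_cons, List.flatten_cons] at h
      simpa [hW, hY] using h
    rcases List.append_eq_append_iff.1 h with ⟨t, h₁, -⟩ | ⟨t, -, h₂⟩
    · exact ⟨w, by simp, ⟨p, t, h₁.symm⟩⟩
    · obtain ⟨v, hv, hy⟩ := List.exists_infix_of_flatten_replicate_infix y (w' :: ws) (by simp)
        ⟨t, s, by rw [← hW, ← hY, h₂, List.append_assoc]⟩
      exact ⟨v, List.mem_cons_of_mem _ hv, hy⟩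

theorem List.infix_flatten_of_mem {α : Type*} {w : List α} {ws : List (List α)} (h : w ∈ ws) :
    w <:+: ws.flatten := by
  obtain ⟨s, t, rfl⟩ := List.append_of_mem h
  exact ⟨s.flatten, t.flatten, by simp⟩

/-! ### Sweeps of the worktape head and their cell-by-cell description -/

namespace NTM

/-- A machine state together with a finite stretch of the worktape around the head, seen in a
direction of travel: `back` lists the cells behind the head and `ahead` those in front of it,
the nearest first. -/
structure Zipper (Q Γ : Type*) where
  state : Q
  back : List Γ
  sym : Γ
  ahead : List Γ

/-- A zipper as a word of cells in the direction of travel; the cell under the head carries the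
state. -/
def Zipper.word {Q Γ : Type*} (z : Zipper Q Γ) : List (Γ × Option Q) :=
  z.back.reverse.map (fun x => (x, none)) ++
    (z.sym, some z.state) :: z.ahead.map (fun x => (x, none))

/-- The same zipper seen in the opposite direction of travel. -/
def Zipper.swap {Q Γ : Type*} (z : Zipper Q Γ) : Zipper Q Γ :=
  ⟨z.state, z.ahead, z.sym, z.back⟩

theorem Zipper.word_swap {Q Γ : Type*} (z : Zipper Q Γ) : z.swap.word = z.word.reverse := by
  simp [Zipper.word, Zipper.swap]

variable {Q α Γ : Type*}

/-- `Sweep M d z w n z'`: by `n` steps that never move the head against the direction `d` and read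
the word `w`, the machine passes from `z` to `z'`. The zippers are seen in direction `d`. -/
inductive Sweep (M : NTM Q α Γ) (d : Turing.Dir) :
    Zipper Q Γ → List α → ℕ → Zipper Q Γ → Prop
  | refl (z : Zipper Q Γ) : Sweep M d z [] 0 z
  | stay {q q' : Q} {a : Option α} {x x' : Γ} {l r : List Γ} {w : List α} {n : ℕ}
      {z : Zipper Q Γ} : ((q, a, x), (q', x', none)) ∈ M.trans →
      Sweep M d ⟨q', l, x', r⟩ w n z → Sweep M d ⟨q, l, x, r⟩ (a.toList ++ w) (n + 1) z
  | move {q q' : Q} {a : Option α} {x x' y : Γ} {l r : List Γ} {w : List α} {n : ℕ}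
      {z : Zipper Q Γ} : ((q, a, x), (q', x', some d)) ∈ M.trans →
      Sweep M d ⟨q', x' :: l, y, r⟩ w n z → Sweep M d ⟨q, l, x, y :: r⟩ (a.toList ++ w) (n + 1) z

/-- The status of a sweep at the boundary between two cells: the sweep starts further on, it
crosses the boundary in a certain state, or it has ended before. -/
inductive SweepState (Q : Type*)
  | before
  | crossing (q : Q)
  | after

/-- The edges of the graph of stationary steps. -/
def DwellEdge (M : NTM Q α Γ) (p : Q × Γ) (a : Option α) (p' : Q × Γ) : Prop :=
  ((p.1, a, p.2), (p'.1, p'.2, none)) ∈ M.trans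

/-- `Enters s g p`: a sweep with status `s` at the near boundary of a cell with entry `g` begins
its stay at this cell with the state and symbol `p`. -/
inductive Enters : SweepState Q → Γ × Option Q → Q × Γ → Prop
  | start (q : Q) (x : Γ) : Enters .before (x, some q) (q, x)
  | cross (q : Q) (x : Γ) : Enters (.crossing q) (x, none) (q, x)

/-- `Leaves M d p a g s`: a sweep in direction `d` may end its stay at a cell with the state and
symbol `p`, reading `a`, leaving the entry `g` in the cell and having status `s` at the far
boundary. Either the sweep stops there, or the head moves on. -/
inductive Leaves (M : NTM Q α Γ) (d : Turing.Dir) :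
    Q × Γ → Option α → Γ × Option Q → SweepState Q → Prop
  | finish (q : Q) (x : Γ) : Leaves M d (q, x) none (x, some q) .after
  | move {q q' : Q} {x x' : Γ} {a : Option α} : ((q, a, x), (q', x', some d)) ∈ M.trans →
      Leaves M d (q, x) a (x', none) (.crossing q')

/-- `Cell M d s g u n s'`: a sweep in direction `d` may have the status `s` and `s'` at the near
and the far boundary of a cell, which it changes from `g.1` to `g.2`, reading `u` in at
most `n` steps. -/
inductive Cell (M : NTM Q α Γ) (d : Turing.Dir) :
    SweepState Q → (Γ × Option Q) × (Γ × Option Q) → List α → ℕ → SweepState Q → Prop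
  | before (x : Γ) : Cell M d .before ((x, none), (x, none)) [] 0 .before
  | after (x : Γ) : Cell M d .after ((x, none), (x, none)) [] 0 .after
  | visit {s s' : SweepState Q} {g g' : Γ × Option Q} {p p' : Q × Γ} {u : List α} {n : ℕ}
      {a : Option α} : Enters s g p → EpsPath M.DwellEdge p u n p' → Leaves M d p' a g' s' →
      Cell M d s (g, g') (u ++ a.toList) (n + 1) s'

/-- If it does not matter what a sweep reads at a cell, its stay may be taken without repeating a
combination of state and symbol. -/
theorem Cell.exists_short [Finite Q] [Finite Γ] {M : NTM Q α Γ} {d : Turing.Dir}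
    {s s' : SweepState Q} {g : (Γ × Option Q) × (Γ × Option Q)} {u : List α} {n : ℕ}
    (h : Cell M d s g u n s') :
    ∃ u', ∃ n' ≤ Nat.card Q * Nat.card Γ + 1, Cell M d s g u' n' s' := by
  cases h with
  | before x => exact ⟨_, _, Nat.zero_le _, .before x⟩
  | after x => exact ⟨_, _, Nat.zero_le _, .after x⟩
  | visit h₁ h₂ h₃ =>
    obtain ⟨m, hm, y, hy⟩ := h₂.shorten_unlabelled
    rw [Nat.card_prod] at hm
    exact ⟨_, _, by omega, .visit h₁ hy h₃⟩

/-- Beyond the end of a sweep no cell is changed and nothing is read. -/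
theorem eq_of_costPath_after {M : NTM Q α Γ} {d : Turing.Dir}
    {ps : List ((Γ × Option Q) × (Γ × Option Q))} {u : List α} {n : ℕ}
    {t : SweepState Q} (h : CostPath (Cell M d) .after ps u n t) :
    ∃ r : List Γ, ps = r.map (fun x => ((x, none), (x, none))) ∧ u = [] := by
  generalize hs : SweepState.after = s at h
  induction h with
  | nil s => exact ⟨[], rfl, rfl⟩
  | cons h _ ih =>
    subst hs
    cases h with
    | after x =>
      obtain ⟨r, hr, hu⟩ := ih rfl
      exact ⟨x :: r, by simp [hr], by simp [hu]⟩
    | visit h₁ _ _ => cases h₁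

/-- Once a stay at a cell is followed by a stop or by a path through the cells in front, it extends
to a sweep, whatever lies behind the cell. -/
theorem exists_sweep_of_visit {M : NTM Q α Γ} {d : Turing.Dir} {p p' : Q × Γ} {u v : List α}
    {m n : ℕ} {a : Option α} {g : Γ × Option Q} {s : SweepState Q}
    {ps : List ((Γ × Option Q) × (Γ × Option Q))}
    (h₁ : EpsPath M.DwellEdge p u m p') (h₂ : Leaves M d p' a g s)
    (h₃ : CostPath (Cell M d) s ps v n .after) :
    ∃ r b q' x' r', ∃ k ≤ m + 1 + n, ps.map Prod.fst = r.map (fun x => (x, none)) ∧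
      g :: ps.map Prod.snd = (Zipper.word ⟨q', b, x', r'⟩) ∧
      ∀ l, Sweep M d ⟨p.1, l, p.2, r⟩ (u ++ a.toList ++ v) k ⟨q', b ++ l, x', r'⟩ := by
  induction ps generalizing p p' u v m n a g s with
  | nil =>
    cases h₃
    cases h₂ with
    | finish q x =>
      refine ⟨[], [], q, x, [], m, by omega, by simp, by simp [Zipper.word], fun l => ?_⟩
      simp only [Option.toList_none, List.append_nil, List.nil_append]
      generalize hp : (q, x) = p' at h₁
      induction h₁ with
      | nil p => subst hp; exact .refl _
      | cons he _ ih => exact .stay he (ih hp)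
  | cons c ps ih =>
    -- the sweep obtained at the end of the stay is preceded by the stationary steps
    suffices H : ∃ r b q' x' r', ∃ k ≤ 1 + n, (c :: ps).map Prod.fst = r.map (fun x => (x, none)) ∧
        g :: (c :: ps).map Prod.snd = (Zipper.word ⟨q', b, x', r'⟩) ∧
        ∀ l, Sweep M d ⟨p'.1, l, p'.2, r⟩ (a.toList ++ v) k ⟨q', b ++ l, x', r'⟩ by
      obtain ⟨r, b, q', x', r', k, hk, hf, hg, hs⟩ := H
      refine ⟨r, b, q', x', r', m + k, by omega, hf, hg, fun l => ?_⟩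
      clear h₂ h₃ ih
      induction h₁ with
      | nil p => simpa using hs l
      | cons he _ ih =>
        rw [Nat.add_right_comm, List.append_assoc, List.append_assoc]
        exact .stay he (by simpa using ih hs)
    cases h₂ with
    | finish q x =>
      obtain ⟨r, hr, rfl⟩ := eq_of_costPath_after h₃
      refine ⟨r, [], q, x, r, 0, by omega, by simp [hr], by simp [Zipper.word, hr], fun l => ?_⟩
      exact .refl _
    | @move q q' x x' a ht =>
      cases h₃ with
      | cons hc hps =>
        cases hc with
        | visit he hd hl =>
          cases he with
          | cross q' y =>
            obtain ⟨r, b, q₁, x₁, r₁, k, hk, hf, hg, hs⟩ := ih hd hl hps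
            refine ⟨y :: r, b ++ [x'], q₁, x₁, r₁, k + 1, by omega, by simp [hf], ?_, fun l => ?_⟩
            · simp only [List.map_cons, hg]
              simp [Zipper.word]
            · simpa using Sweep.move ht (hs (x' :: l))

/-- A path through cells that contains a whole sweep is the track of such a sweep. -/
theorem exists_sweep_of_costPath {M : NTM Q α Γ} {d : Turing.Dir}
    {ps : List ((Γ × Option Q) × (Γ × Option Q))} {u : List α} {n : ℕ}
    (h : CostPath (Cell M d) .before ps u n .after) :
    ∃ z z', ∃ k ≤ n, ps.map Prod.fst = Zipper.word z ∧ ps.map Prod.snd = Zipper.word z' ∧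
      Sweep M d z u k z' := by
  -- the cells in front of the starting point are put behind a sweep that starts further on
  suffices H : ∃ q y x r q' b x' r', ∃ k ≤ n, ps.map Prod.fst = Zipper.word ⟨q, y, x, r⟩ ∧
      ps.map Prod.snd = Zipper.word ⟨q', b ++ y, x', r'⟩ ∧
      ∀ l, Sweep M d ⟨q, y ++ l, x, r⟩ u k ⟨q', b ++ y ++ l, x', r'⟩ by
    obtain ⟨q, y, x, r, q', b, x', r', k, hk, hf, hg, hs⟩ := H
    exact ⟨_, _, k, hk, hf, hg, by simpa using hs []⟩
  generalize hs : SweepState.before = s at h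
  generalize ht : SweepState.after = t at h
  induction h with
  | nil s => subst hs; cases ht
  | cons h hps ih =>
    subst hs ht
    cases h with
    | before x₀ =>
      obtain ⟨q, y, x, r, q', b, x', r', k, hk, hf, hg, hs⟩ := ih rfl rfl
      refine ⟨q, y ++ [x₀], x, r, q', b, x', r', k, by omega, ?_, ?_, fun l => ?_⟩
      · simp [hf, Zipper.word]
      · simp [hg, Zipper.word]
      · simpa using hs (x₀ :: l)
    | visit h₁ h₂ h₃ =>
      cases h₁ with
      | start q x =>
        obtain ⟨r, b, q', x', r', k, hk, hf, hg, hs⟩ := exists_sweep_of_visit h₂ h₃ hps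
        refine ⟨q, [], x, r, q', b, x', r', k, hk, ?_, ?_, fun l => ?_⟩
        · simp [hf, Zipper.word]
        · simpa [Zipper.word] using hg
        · simpa using hs l

/-- What a sweep does to the cell under the head and to those in front of it. -/
theorem Sweep.exists_visit {M : NTM Q α Γ} {d : Turing.Dir} {z z' : Zipper Q Γ} {w : List α}
    {n : ℕ} (h : Sweep M d z w n z') :
    ∃ u a v m k p' g s ps, w = u ++ Option.toList a ++ v ∧
      EpsPath M.DwellEdge (z.state, z.sym) u m p' ∧ Leaves M d p' a g s ∧
      CostPath (Cell M d) s ps v k .after ∧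
      ps.map Prod.fst = z.ahead.map (fun x => (x, none)) ∧
      z'.word = z.back.reverse.map (fun x => (x, none)) ++ g :: ps.map Prod.snd := by
  induction h with
  | refl z =>
    refine ⟨[], none, [], 0, 0, (z.state, z.sym), (z.sym, some z.state), .after,
      z.ahead.map (fun x => ((x, none), (x, none))), rfl, .nil _, .finish _ _, ?_, ?_, ?_⟩
    · generalize z.ahead = r
      induction r with
      | nil => exact .nil _
      | cons x r ih => exact .cons (.after x) ih
    · simp
    · simp [Zipper.word]
  | @stay q q' a₀ x x' l r w n z ht _ ih =>
    obtain ⟨u, a, v, m, k, p', g, s, ps, rfl, h₁, h₂, h₃, h₄, h₅⟩ := ih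
    exact ⟨a₀.toList ++ u, a, v, m + 1, k, p', g, s, ps, by simp,
      EpsPath.cons (E := M.DwellEdge) (x := (q, x)) (x' := (q', x')) ht h₁, h₂, h₃, h₄, h₅⟩
  | @move q q' a₀ x x' y l r w n z ht _ ih =>
    obtain ⟨u, a, v, m, k, p', g, s, ps, rfl, h₁, h₂, h₃, h₄, h₅⟩ := ih
    exact ⟨[], a₀, u ++ a.toList ++ v, 0, m + 1 + k, (q, x), (x', none), .crossing q',
      ((y, none), g) :: ps, by simp, .nil _, .move ht,
      .cons (.visit (.cross q' y) h₁ h₂) h₃, by simp [h₄], by simp [h₅]⟩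

/-- The track of a sweep is a path through the cells, which leads from the word of the first zipper
to that of the last one and reads what the sweep reads. -/
theorem Sweep.exists_costPath {M : NTM Q α Γ} {d : Turing.Dir} {z z' : Zipper Q Γ} {w : List α}
    {n : ℕ} (h : Sweep M d z w n z') :
    ∃ ps k, ps.map Prod.fst = z.word ∧ ps.map Prod.snd = z'.word ∧
      CostPath (Cell M d) .before ps w k .after := by
  obtain ⟨u, a, v, m, k, p', g, s, ps, rfl, h₁, h₂, h₃, h₄, h₅⟩ := h.exists_visit
  have hp : CostPath (Cell M d) .before (((z.sym, some z.state), g) :: ps)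
      (u ++ a.toList ++ v) (m + 1 + k) .after := .cons (.visit (.start _ _) h₁ h₂) h₃
  refine ⟨z.back.reverse.map (fun x => ((x, none), (x, none))) ++
    ((z.sym, some z.state), g) :: ps, m + 1 + k, ?_, ?_, ?_⟩
  · simp [h₄, Zipper.word]
  · simp [h₅]
  · clear h₅
    generalize z.back.reverse = l
    induction l with
    | nil => exact hp
    | cons x l ih => simpa using CostPath.cons (.before x) ih

end NTM

/-! ### Computations as sequences of sweeps -/

namespace NTM

/-- The opposite direction. -/
def opposite : Turing.Dir → Turing.Dir
  | .left => .right
  | .right => .left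

theorem eq_opposite_of_ne {d e : Turing.Dir} (h : e ≠ d) : e = opposite d := by
  cases d <;> cases e <;> simp_all [opposite]

/-- The passage between a zipper seen from left to right and the same zipper seen in direction
`d`; it is an involution. -/
def orient {Q Γ : Type*} (d : Turing.Dir) (z : Zipper Q Γ) : Zipper Q Γ :=
  match d with
  | .left => z.swap
  | .right => z

@[simp]
theorem orient_orient {Q Γ : Type*} (d : Turing.Dir) (z : Zipper Q Γ) :
    orient d (orient d z) = z := by
  cases d <;> rfl

@[simp]
theorem orient_state {Q Γ : Type*} (d : Turing.Dir) (z : Zipper Q Γ) :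
    (orient d z).state = z.state := by
  cases d <;> rfl

@[simp]
theorem orient_sym {Q Γ : Type*} (d : Turing.Dir) (z : Zipper Q Γ) :
    (orient d z).sym = z.sym := by
  cases d <;> rfl

variable {Q α Γ : Type*}

/-- `Sweeps M d z ws z'`: consecutive sweeps in alternating directions, the first one in direction
`d`, lead from `z` to `z'` and read the words `ws`. The zippers are seen from left to right. -/
inductive Sweeps (M : NTM Q α Γ) : Turing.Dir → Zipper Q Γ → List (List α) → Zipper Q Γ → Prop
  | nil (d : Turing.Dir) (z : Zipper Q Γ) : Sweeps M d z [] z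
  | cons {d : Turing.Dir} {z z' z'' : Zipper Q Γ} {w : List α} {n : ℕ} {ws : List (List α)} :
      Sweep M d (orient d z) w n (orient d z') → Sweeps M (opposite d) z' ws z'' →
      Sweeps M d z (w :: ws) z''

theorem Sweeps.exists_seq {M : NTM Q α Γ} {d : Turing.Dir} {z z' : Zipper Q Γ}
    {ws : List (List α)} (h : Sweeps M d z ws z') :
    ∃ Z : ℕ → Zipper Q Γ, Z 0 = z ∧ Z ws.length = z' ∧ ∀ j (hj : j < ws.length), ∃ n,
      Sweep M (opposite^[j] d) (orient (opposite^[j] d) (Z j)) ws[j] n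
        (orient (opposite^[j] d) (Z (j + 1))) := by
  induction h with
  | nil d z => exact ⟨fun _ => z, rfl, rfl, fun j hj => absurd hj (by simp)⟩
  | @cons d z z' z'' w n ws hs _ ih =>
    obtain ⟨Z, h0, hK, hZ⟩ := ih
    refine ⟨fun j => Nat.casesOn j z Z, rfl, hK, fun j hj => ?_⟩
    cases j with
    | zero => exact ⟨n, by simpa [h0] using hs⟩
    | succ j => exact hZ j (by simpa using hj)

theorem Sweeps.replicate_nil (M : NTM Q α Γ) (d : Turing.Dir) (z : Zipper Q Γ) (K : ℕ) :
    Sweeps M d z (List.replicate K []) z := by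
  induction K generalizing d with
  | zero => exact .nil d z
  | succ K ih => exact .cons (.refl _) (ih _)

variable [Inhabited Γ]

/-- The worktape of a zipper seen from left to right: all cells outside the stretch are blank. -/
def Zipper.tape (z : Zipper Q Γ) : Turing.Tape Γ :=
  Turing.Tape.mk₂ z.back (z.sym :: z.ahead)

theorem Zipper.tape_head (z : Zipper Q Γ) : z.tape.head = z.sym := rfl

theorem listBlank_mk_replicate (n : ℕ) :
    Turing.ListBlank.mk (List.replicate n (default : Γ)) = default := by
  refine Turing.ListBlank.ext fun i => ?_
  rw [show (default : Turing.ListBlank Γ) = Turing.ListBlank.mk [] from rfl,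
    Turing.ListBlank.nth_mk, Turing.ListBlank.nth_mk, List.getI_nil]
  by_cases h : i < n
  · rw [List.getI_eq_getElem _ (by simpa using h), List.getElem_replicate]
  · rw [List.getI_eq_default _ (by simpa using h)]

theorem tape_replicate_default (q : Q) (m n : ℕ) :
    (Zipper.mk q (List.replicate m (default : Γ)) default (List.replicate n default)).tape =
      default := by
  simp only [Zipper.tape, Turing.Tape.mk₂, Turing.Tape.mk', ← Turing.ListBlank.cons_mk,
    Turing.ListBlank.head_cons, Turing.ListBlank.tail_cons, listBlank_mk_replicate]
  rfl

/-- The initial zipper with `n` blank cells on either side of the head. -/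
def blankZipper (q : Q) (n : ℕ) : Zipper Q Γ :=
  ⟨q, List.replicate n default, default, List.replicate n default⟩

theorem tape_write (z : Zipper Q Γ) (q : Q) (y : Γ) :
    z.tape.write y = (Zipper.mk q z.back y z.ahead).tape := by
  simp [Zipper.tape, Turing.Tape.mk₂, ← Turing.ListBlank.cons_mk]

theorem tape_orient_move (d : Turing.Dir) (q q' : Q) (l r : List Γ) (x y : Γ) :
    (orient d ⟨q, l, x, y :: r⟩).tape.move d = (orient d ⟨q', x :: l, y, r⟩).tape := by
  cases d <;> simp [orient, Zipper.swap, Zipper.tape, Turing.Tape.mk₂, ← Turing.ListBlank.cons_mk]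

theorem Run.trans {M : NTM Q α Γ} {C C' C'' : Cfg Q α Γ} {ms ms' : List (Option Turing.Dir)}
    (h : M.Run C ms C') (h' : M.Run C' ms' C'') : M.Run C (ms ++ ms') C'' := by
  induction h with
  | refl C => exact h'
  | cons hs _ ih => exact .cons hs (ih h')

/-- A sweep is a computation on the worktape that is blank outside of the stretch. -/
theorem Sweep.exists_run {M : NTM Q α Γ} {d : Turing.Dir} {z z' : Zipper Q Γ} {w : List α}
    {n : ℕ} (h : Sweep M d z w n z') (v : List α) :
    ∃ ms, ms.length = n ∧ M.Run ⟨z.state, w ++ v, (orient d z).tape⟩ ms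
      ⟨z'.state, v, (orient d z').tape⟩ := by
  induction h with
  | refl z => exact ⟨[], rfl, .refl _⟩
  | @stay q q' a x x' l r w n z ht _ ih =>
    obtain ⟨ms, rfl, hr⟩ := ih
    refine ⟨none :: ms, rfl, .cons ?_ hr⟩
    have := Step.mk (M := M) (T := (orient d ⟨q, l, x, r⟩).tape) (a := a) (q := q) (q' := q')
      (d := x') (m := none) (by rw [Zipper.tape_head, orient_sym]; exact ht) (w ++ v)
    rw [tape_write _ q', ← List.append_assoc] at this
    cases d <;> exact this
  | @move q q' a x x' y l r w n z ht _ ih =>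
    obtain ⟨ms, rfl, hr⟩ := ih
    refine ⟨some d :: ms, rfl, .cons ?_ hr⟩
    have := Step.mk (M := M) (T := (orient d ⟨q, l, x, y :: r⟩).tape) (a := a) (q := q) (q' := q')
      (d := x') (m := some d) (by rw [Zipper.tape_head, orient_sym]; exact ht) (w ++ v)
    rw [tape_write _ q', ← List.append_assoc] at this
    have hm := tape_orient_move d q q' l r x' y
    rw [← hm]
    cases d <;> exact this

/-- Sweeps in arbitrary directions, each continuing the preceding one, make up a computation. -/
theorem exists_run_of_sweeps {M : NTM Q α Γ} (D : ℕ → Turing.Dir) (Z : ℕ → Zipper Q Γ)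
    (W : ℕ → List α) (N : ℕ → ℕ) (K : ℕ)
    (h : ∀ j < K, Sweep M (D j) (orient (D j) (Z j)) (W j) (N j) (orient (D j) (Z (j + 1))))
    (v : List α) :
    ∃ ms, ms.length = ∑ j ∈ Finset.range K, N j ∧
      M.Run ⟨(Z 0).state, ((List.range K).map W).flatten ++ v, (Z 0).tape⟩ ms
        ⟨(Z K).state, v, (Z K).tape⟩ := by
  induction K generalizing v with
  | zero => exact ⟨[], by simp, .refl _⟩
  | succ K ih =>
    obtain ⟨ms, hl, hr⟩ := ih (fun j hj => h j (by omega)) (W K ++ v)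
    obtain ⟨ms', hl', hr'⟩ := (h K (by omega)).exists_run v
    simp only [orient_state, orient_orient] at hr'
    refine ⟨ms ++ ms', by rw [Finset.sum_range_succ, List.length_append, hl, hl'], ?_⟩
    rw [List.range_succ, List.map_append, List.flatten_append, List.append_assoc]
    simpa using hr.trans hr'

theorem reversals_cons_none (d : Turing.Dir) (ms : List (Option Turing.Dir)) :
    reversals (some d :: none :: ms) = reversals (some d :: ms) := by
  simp [reversals]

theorem reversals_cons_some (d e : Turing.Dir) (ms : List (Option Turing.Dir)) :
    reversals (some d :: some e :: ms) =
      reversals (some e :: ms) + if d = e then 0 else 1 := by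
  by_cases h : d = e <;> simp [reversals, h]

theorem reversals_cons_le (d : Turing.Dir) (ms : List (Option Turing.Dir)) :
    reversals (some d :: ms) ≤ reversals ms + 1 := by
  simp only [reversals, List.reduceOption_cons_of_some, List.tail_cons]
  rcases ms.reduceOption with _ | ⟨e, l⟩
  · simp
  · by_cases h : d = e <;> simp [h]

/-- A computation with few reversals is a short sequence of sweeps, provided that the zipper at its
start reaches far enough to both sides. -/
theorem Run.exists_sweeps {M : NTM Q α Γ} {C C' : Cfg Q α Γ} {ms : List (Option Turing.Dir)}
    (h : M.Run C ms C') (z : Zipper Q Γ) (hstate : C.state = z.state) (htape : C.tape = z.tape)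
    (hback : ms.length ≤ z.back.length) (hahead : ms.length ≤ z.ahead.length)
    (d : Turing.Dir) (K : ℕ) (hK : reversals (some d :: ms) < K) :
    ∃ ws z', ws.length = K ∧ Sweeps M d z ws z' ∧ z'.state = C'.state ∧
      C.input = ws.flatten ++ C'.input := by
  induction h generalizing z d K with
  | refl C =>
    exact ⟨_, z, by simp, Sweeps.replicate_nil M d z K, hstate.symm, by simp⟩
  | @cons C C₁ C' m ms hs hr ih =>
    obtain ⟨ht, w⟩ := hs
    rename_i q q' a y T
    obtain ⟨q₀, l, x, r⟩ := z
    simp only at hstate htape hback hahead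
    subst hstate htape
    rw [Zipper.tape_head] at ht
    simp only [List.length_cons] at hback hahead
    rcases m with _ | e
    · rw [reversals_cons_none] at hK
      obtain ⟨ws, z', hl, hsw, hq, hw⟩ := ih ⟨q', l, y, r⟩ rfl
        (by simp only [moveHead]; exact tape_write _ q' y) (by simp only; omega)
        (by simp only; omega) d K hK
      cases hsw with
      | nil => simp at hl; omega
      | @cons _ _ z₁ _ w₁ n ws h₁ h₂ =>
        refine ⟨(a.toList ++ w₁) :: ws, z', hl, .cons (z' := z₁) (n := n + 1) ?_ h₂, hq, ?_⟩
        · cases d <;> exact .stay ht h₁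
        · simp only at hw ⊢
          simp [hw]
    · rw [reversals_cons_some] at hK
      -- the move of the first step as a sweep in its own direction
      obtain ⟨z₁, hz₁, hb₁, ha₁, hq₁, hsw₁⟩ : ∃ z₁ : Zipper Q Γ,
          z₁.tape = ((⟨q, l, x, r⟩ : Zipper Q Γ).tape.write y).move e ∧
          ms.length ≤ z₁.back.length ∧ ms.length ≤ z₁.ahead.length ∧ z₁.state = q' ∧
          ∀ w n z, Sweep M e (orient e z₁) w n z →
            Sweep M e (orient e ⟨q, l, x, r⟩) (a.toList ++ w) (n + 1) z := by
        rw [tape_write _ q']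
        cases e with
        | left =>
          rcases l with _ | ⟨x₁, l⟩
          · simp at hback
          · exact ⟨⟨q', l, x₁, y :: r⟩, (tape_orient_move .left q' q' r l y x₁).symm,
              by simp at hback ⊢; omega, by simp at hahead ⊢; omega, rfl,
              fun w n z h => .move ht h⟩
        | right =>
          rcases r with _ | ⟨x₁, r⟩
          · simp at hahead
          · exact ⟨⟨q', y :: l, x₁, r⟩, (tape_orient_move .right q' q' l r y x₁).symm,
              by simp at hback ⊢; omega, by simp at hahead ⊢; omega, rfl,
              fun w n z h => .move ht h⟩
      have key : ∀ K, reversals (some e :: ms) < K → ∃ ws z', ws.length = K ∧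
          Sweeps M e ⟨q, l, x, r⟩ ws z' ∧ z'.state = C'.state ∧
          a.toList ++ w = ws.flatten ++ C'.input := by
        intro K hK
        obtain ⟨ws, z', hl, hsw, hq, hw⟩ := ih z₁ hq₁.symm hz₁.symm hb₁ ha₁ e K hK
        cases hsw with
        | nil => simp at hl; omega
        | @cons _ _ z₂ _ w₁ n ws h₁ h₂ =>
          refine ⟨(a.toList ++ w₁) :: ws, z', hl, .cons (hsw₁ _ _ _ h₁) h₂, hq, ?_⟩
          simp only at hw
          simp [hw]
      by_cases hde : d = e
      · subst hde
        exact key K (by simpa using hK)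
      · rw [if_neg hde] at hK
        obtain ⟨ws, z', hl, hsw, hq, hw⟩ := key (K - 1) (by omega)
        refine ⟨[] :: ws, z', by simp [hl]; omega, .cons (.refl _) ?_, hq, by simpa using hw⟩
        rwa [← eq_opposite_of_ne (Ne.symm hde)]

end NTM

/-! ### All sweeps side by side -/

theorem List.eq_of_map_fst_eq_of_map_snd_eq {α β : Type*} {l l' : List (α × β)}
    (h₁ : l.map Prod.fst = l'.map Prod.fst) (h₂ : l.map Prod.snd = l'.map Prod.snd) : l = l' := by
  rw [← List.zip_unzip l, ← List.zip_unzip l', List.unzip_eq_map, List.unzip_eq_map, h₁, h₂]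

/-- Paths for the several components of a family of states, which process the same list, are the
components of one path of the family. One component, `i`, also reads words. -/
theorem CostPath.of_components {ι S C B α : Type*} (i : ι) {f : ι → C → B}
    {R : ι → S → B → S → Prop} {T : S → B → List α → ℕ → S → Prop} {P : C → Prop}
    {cs : List C} {s s' : ι → S} {u : List α} {n : ℕ} (hP : ∀ c ∈ cs, P c)
    (hR : ∀ j ≠ i, ListPath (R j) (s j) (cs.map (f j)) (s' j))
    (hT : CostPath T (s i) (cs.map (f i)) u n (s' i)) :
    CostPath (fun s c u n s' => (P c ∧ ∀ j ≠ i, R j (s j) (f j c) (s' j)) ∧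
      T (s i) (f i c) u n (s' i)) s cs u n s' := by
  classical
  induction cs generalizing s u n with
  | nil =>
    have hs : s = s' := by
      funext j
      by_cases hj : j = i
      · subst hj
        generalize s j = a, s' j = b at hT
        cases hT
        rfl
      · have := hR j hj
        generalize s j = a, s' j = b at this
        cases this
        rfl
    subst hs
    generalize s i = a at hT
    cases hT
    exact .nil s
  | cons c cs ih =>
    have hR' : ∀ j, ∃ t, j ≠ i → R j (s j) (f j c) t ∧ ListPath (R j) t (cs.map (f j)) (s' j) := by
      intro j
      by_cases hj : j = i
      · exact ⟨s j, fun h => absurd hj h⟩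
      · have := hR j hj
        simp only [List.map_cons] at this
        cases this with
        | cons h₁ h₂ => exact ⟨_, fun _ => ⟨h₁, h₂⟩⟩
    choose t ht using hR'
    simp only [List.map_cons] at hT
    cases hT with
    | @cons _ ti _ _ _ v w m k h₁ h₂ =>
      refine .cons (s' := Function.update t i ti) ⟨⟨hP c (by simp), fun j hj => ?_⟩, ?_⟩
        (ih (fun c hc => hP c (by simp [hc])) (fun j hj => ?_) ?_)
      · simpa [hj] using (ht j hj).1
      · simpa using h₁
      · simpa [hj] using (ht j hj).2
      · simpa using h₂

theorem CostPath.component {ι S C B α : Type*} (i : ι) {f : ι → C → B}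
    {R : ι → S → B → S → Prop} {T : S → B → List α → ℕ → S → Prop} {P : C → Prop}
    {cs : List C} {s s' : ι → S} {u : List α} {n : ℕ}
    (h : CostPath (fun s c u n s' => (P c ∧ ∀ j ≠ i, R j (s j) (f j c) (s' j)) ∧
      T (s i) (f i c) u n (s' i)) s cs u n s') :
    (∀ c ∈ cs, P c) ∧ (∀ j ≠ i, ListPath (R j) (s j) (cs.map (f j)) (s' j)) ∧
      CostPath T (s i) (cs.map (f i)) u n (s' i) := by
  induction h with
  | nil s => exact ⟨by simp, fun j _ => .nil _, .nil _⟩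
  | cons h _ ih =>
    exact ⟨by simpa using ⟨h.1.1, ih.1⟩, fun j hj => .cons (h.1.2 j hj) (ih.2.1 j hj),
      .cons h.2 ih.2.2⟩

namespace NTM

variable {Q α Γ : Type*}

/-- A zipper is determined by its word. Hence sweeps whose words fit together can be joined. -/
theorem Zipper.word_injective : Function.Injective (Zipper.word (Q := Q) (Γ := Γ)) := by
  rintro ⟨q, l, x, r⟩ ⟨q', l', x', r'⟩ h
  have hmap : Function.Injective (List.map (fun x : Γ => (x, (none : Option Q)))) :=
    List.map_injective_iff.2 fun x y h => (Prod.mk.inj h).1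
  have key : ∀ l l' : List Γ,
      l.map (fun x => (x, none)) ++ (x, some q) :: r.map (fun x => (x, none)) =
        l'.map (fun x => (x, none)) ++ (x', some q') :: r'.map (fun x => (x, none)) →
      q = q' ∧ l = l' ∧ x = x' ∧ r = r' := by
    intro l
    induction l with
    | nil =>
      rintro (_ | ⟨y, l'⟩) h
      · simp only [List.map_nil, List.nil_append, List.cons.injEq, Prod.mk.injEq,
          Option.some.injEq] at h
        exact ⟨h.1.2, rfl, h.1.1, hmap h.2⟩
      · simp at h
    | cons z l ih =>
      rintro (_ | ⟨y, l'⟩) h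
      · simp at h
      · simp only [List.map_cons, List.cons_append, List.cons.injEq, Prod.mk.injEq, and_true] at h
        obtain ⟨h₁, h₂, h₃, h₄⟩ := ih l' h.2
        exact ⟨h₁, by rw [h.1, h₂], h₃, h₄⟩
  obtain ⟨rfl, h, rfl, rfl⟩ := key _ _ h
  obtain rfl : l = l' := List.reverse_injective h
  rfl

theorem mem_word {z : Zipper Q Γ} {g : Γ × Option Q} (h : g ∈ z.word) :
    (g.1 ∈ z.back ∨ g.1 = z.sym ∨ g.1 ∈ z.ahead) ∧ ∀ q ∈ g.2, q = z.state := by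
  simp only [Zipper.word, List.mem_append, List.mem_map, List.mem_reverse, List.mem_cons] at h
  rcases h with ⟨x, hx, rfl⟩ | rfl | ⟨x, hx, rfl⟩ <;> simp_all

theorem mem_word_orient {d : Turing.Dir} {z : Zipper Q Γ} {g : Γ × Option Q} :
    g ∈ (orient d z).word ↔ g ∈ z.word := by
  cases d <;> simp [orient, Zipper.word_swap]

theorem word_orient (d e : Turing.Dir) [Decidable (d = e)] (z : Zipper Q Γ) :
    (orient d z).word = if d = e then (orient e z).word else (orient e z).word.reverse := by
  split_ifs with h
  · rw [h]
  · cases d <;> cases e <;> simp_all [orient, Zipper.word_swap]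

instance [Finite Q] : Finite (SweepState Q) :=
  Finite.of_surjective (fun o : Option (Option Q) => match o with
    | none => SweepState.before
    | some none => .after
    | some (some q) => .crossing q)
    (by rintro (_ | q | _)
        exacts [⟨none, rfl⟩, ⟨some (some q), rfl⟩, ⟨some none, rfl⟩])

theorem card_sweepState_le [Finite Q] : Nat.card (SweepState Q) ≤ Nat.card Q + 2 := by
  have := Nat.card_le_card_of_injective (fun s : SweepState Q => (match s with
    | .before => none
    | .after => some none
    | .crossing q => some (some q) : Option (Option Q)))
    (by rintro (_ | q | _) (_ | q' | _) h <;> simp_all)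
  simpa [Finite.card_option] using this

/-- The entries of one cell before the first sweep, between any two sweeps and after the last
one of `K` sweeps. -/
abbrev Column (Q Γ : Type*) (K : ℕ) := Fin (K + 1) → Γ × Option Q

/-- What the start and the end of an accepting computation require of a column. -/
def Column.Ok [Inhabited Γ] {K : ℕ} (M : NTM Q α Γ) (c : Column Q Γ K) : Prop :=
  (c 0).1 = default ∧ (∀ q ∈ (c 0).2, q = M.start) ∧ ∀ q ∈ (c (Fin.last K)).2, q ∈ M.final

/-- The part of a column that concerns the sweep `j`: the entries before and after it. -/
def Column.pair {K : ℕ} (j : Fin K) (c : Column Q Γ K) : (Γ × Option Q) × (Γ × Option Q) :=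
  (c j.castSucc, c j.succ)

/-- A sweep in direction `d` at one cell, the cells being inspected in direction `e`. The word that
is read is forgotten, and at most `b` steps are made. -/
def SweepCell (M : NTM Q α Γ) (b : ℕ) (e d : Turing.Dir) (s : SweepState Q)
    (g : (Γ × Option Q) × (Γ × Option Q)) (s' : SweepState Q) : Prop :=
  (d = e → ∃ u, ∃ n ≤ b, Cell M d s g u n s') ∧ (d ≠ e → ∃ u, ∃ n ≤ b, Cell M d s' g u n s)

/-- The status, at the first boundary of the cells inspected in direction `e`, of a sweep in
direction `d`. -/
def nearStatus (e d : Turing.Dir) : SweepState Q :=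
  match e, d with
  | .left, .left => .before
  | .right, .right => .before
  | .left, .right => .after
  | .right, .left => .after

/-- The reading direction of the cells does not matter for a single sweep, as a path may be
traversed backwards. -/
theorem sweepCell_path_iff {M : NTM Q α Γ} {b : ℕ} {e d : Turing.Dir}
    {ps : List ((Γ × Option Q) × (Γ × Option Q))} :
    ListPath (SweepCell M b e d) (nearStatus e d) ps (nearStatus (opposite e) d) ↔
      ListPath (fun s g s' => ∃ u, ∃ n ≤ b, Cell M d s g u n s') .before
        (if d = e then ps else ps.reverse) .after := by
  by_cases h : d = e
  · subst h
    simp only [if_true]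
    have h₁ : (nearStatus d d : SweepState Q) = .before := by cases d <;> rfl
    have h₂ : (nearStatus (opposite d) d : SweepState Q) = .after := by cases d <;> rfl
    rw [h₁, h₂]
    exact ⟨fun h => h.mono fun _ _ _ h => h.1 rfl,
      fun h => h.mono fun _ _ _ h => ⟨fun _ => h, fun h => absurd rfl h⟩⟩
  · rw [if_neg h]
    have h₁ : (nearStatus e d : SweepState Q) = .after := by
      cases d <;> cases e <;> simp_all [nearStatus]
    have h₂ : (nearStatus (opposite e) d : SweepState Q) = .before := by
      cases d <;> cases e <;> simp_all [nearStatus, opposite]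
    rw [h₁, h₂]
    refine ⟨fun hp => hp.reverse.mono fun _ _ _ hc => hc.2 h, fun hp => ?_⟩
    rw [← ps.reverse_reverse]
    exact hp.reverse.mono fun _ _ _ hc => ⟨fun he => absurd he h, fun _ => hc⟩

variable [Inhabited Γ]

/-- The simultaneous passage of all sweeps except the sweep `i` through one cell, in at most `b`
steps each. The cells are inspected in the direction of the sweep `i`. -/
def OtherSweeps (M : NTM Q α Γ) (b : ℕ) {K : ℕ} (D : Fin K → Turing.Dir) (i : Fin K)
    (s : Fin K → SweepState Q) (c : Column Q Γ K) (s' : Fin K → SweepState Q) : Prop :=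
  c.Ok M ∧ ∀ j ≠ i, SweepCell M b (D i) (D j) (s j) (c.pair j) (s' j)

/-- The simultaneous passage of all sweeps through one cell, where the sweep `i` reads `u`. -/
def AllSweeps (M : NTM Q α Γ) (b : ℕ) {K : ℕ} (D : Fin K → Turing.Dir) (i : Fin K)
    (s : Fin K → SweepState Q) (c : Column Q Γ K) (u : List α) (n : ℕ)
    (s' : Fin K → SweepState Q) : Prop :=
  OtherSweeps M b D i s c s' ∧ Cell M (D i) (s i) (c.pair i) u n (s' i)

theorem tape_eq_default {z : Zipper Q Γ} (h : ∀ g ∈ z.word, g.1 = default) :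
    z.tape = default := by
  obtain ⟨q, l, x, r⟩ := z
  have hl : l = List.replicate l.length default :=
    List.eq_replicate_iff.2 ⟨rfl, fun y hy => h (y, none) (by simp [Zipper.word, hy])⟩
  have hr : r = List.replicate r.length default :=
    List.eq_replicate_iff.2 ⟨rfl, fun y hy => h (y, none) (by simp [Zipper.word, hy])⟩
  have hx : x = default := h (x, some q) (by simp [Zipper.word])
  rw [hl, hr, hx]
  exact tape_replicate_default q _ _

/-- A joint passage of all sweeps through the cells of the worktape is an accepting computation. -/
theorem exists_sweeps_of_costPath {M : NTM Q α Γ} {b K : ℕ} {D : Fin K → Turing.Dir} {i : Fin K}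
    {cs : List (Column Q Γ K)} {u : List α} {n : ℕ}
    (h : CostPath (AllSweeps M b D i) (fun j => nearStatus (D i) (D j)) cs u n
      (fun j => nearStatus (opposite (D i)) (D j))) :
    ∃ (Z : Fin (K + 1) → Zipper Q Γ) (W : Fin K → List α) (N : Fin K → ℕ),
      (∀ j, Sweep M (D j) (orient (D j) (Z j.castSucc)) (W j) (N j) (orient (D j) (Z j.succ))) ∧
      (Z 0).tape = default ∧ (Z 0).state = M.start ∧
      (Z (Fin.last K)).state ∈ M.final ∧ W i = u ∧ ∀ j, N j ≤ n + b * cs.length := by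
  obtain ⟨hok, hoth, hi⟩ := CostPath.component (f := Column.pair)
    (R := fun j => SweepCell M b (D i) (D j)) (T := Cell M (D i)) (P := Column.Ok M) i h
  have hstep : ∀ j, ∃ z z' w, ∃ k ≤ n + b * cs.length, (j = i → w = u) ∧
      (orient (D i) z).word = cs.map (fun c => c j.castSucc) ∧
      (orient (D i) z').word = cs.map (fun c => c j.succ) ∧
      Sweep M (D j) (orient (D j) z) w k (orient (D j) z') := by
    intro j
    have hc : ∃ w, ∃ k ≤ n + b * cs.length, (j = i → w = u) ∧ CostPath (Cell M (D j)) .before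
        (if D j = D i then cs.map (Column.pair j) else (cs.map (Column.pair j)).reverse)
        w k .after := by
      by_cases hj : j = i
      · subst hj
        refine ⟨u, n, by omega, fun _ => rfl, ?_⟩
        rw [if_pos rfl]
        convert hi using 1 <;> cases D j <;> rfl
      · obtain ⟨w, k, hk, hp⟩ := CostPath.of_listPath (sweepCell_path_iff.1 (hoth j hj))
        refine ⟨w, k, ?_, fun h => absurd h hj, hp⟩
        split_ifs at hk <;> simp at hk <;> omega
    obtain ⟨w, k, hk, hw, hp⟩ := hc
    obtain ⟨z, z', k', hk', hz, hz', hs⟩ := exists_sweep_of_costPath hp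
    refine ⟨orient (D j) z, orient (D j) z', w, k', by omega, hw, ?_, ?_, by simpa using hs⟩
    · rw [word_orient _ (D j), orient_orient, ← hz]
      by_cases he : D i = D j
      · simp [he, Column.pair]
      · simp [he, Ne.symm he, Column.pair]
    · rw [word_orient _ (D j), orient_orient, ← hz']
      by_cases he : D i = D j
      · simp [he, Column.pair]
      · simp [he, Ne.symm he, Column.pair]
  choose z z' W N hN hW hz hz' hs using hstep
  have hZ : ∀ m, ∃ Z : Zipper Q Γ, (orient (D i) Z).word = cs.map (fun c => c m) := by
    intro m
    cases m using Fin.cases with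
    | zero => exact ⟨_, hz ⟨0, i.pos⟩⟩
    | succ j => exact ⟨_, hz' j⟩
  choose Z hZ using hZ
  have hinj : Function.Injective (fun z : Zipper Q Γ => (orient (D i) z).word) :=
    Zipper.word_injective.comp (Function.LeftInverse.injective (orient_orient (D i)))
  have hzZ : ∀ j, z j = Z j.castSucc := fun j => hinj ((hz j).trans (hZ _).symm)
  have hzZ' : ∀ j, z' j = Z j.succ := fun j => hinj ((hz' j).trans (hZ _).symm)
  -- the entry of the cell under the head satisfies the requirements on columns
  have hmem : ∀ m, ∃ c : Column Q Γ K, c.Ok M ∧ c m = ((Z m).sym, some (Z m).state) := by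
    intro m
    have : ((Z m).sym, some (Z m).state) ∈ (orient (D i) (Z m)).word :=
      mem_word_orient.2 (by simp [Zipper.word])
    rw [hZ] at this
    obtain ⟨c, hc, he⟩ := List.mem_map.1 this
    exact ⟨c, hok c hc, he⟩
  refine ⟨Z, W, N, fun j => ?_, tape_eq_default fun g hg => ?_, ?_, ?_, hW i rfl, hN⟩
  · rw [← hzZ, ← hzZ']
    exact hs j
  · rw [← mem_word_orient (d := D i), hZ] at hg
    obtain ⟨c, hc, rfl⟩ := List.mem_map.1 hg
    exact (hok c hc).1
  · obtain ⟨c, hc, he⟩ := hmem 0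
    exact hc.2.1 _ (by rw [he]; rfl)
  · obtain ⟨c, hc, he⟩ := hmem (Fin.last K)
    exact hc.2.2 _ (by rw [he]; rfl)

/-- The sweeps of an accepting computation pass jointly through the cells of the worktape. -/
theorem exists_costPath_of_sweeps [Finite Q] [Finite Γ] {M : NTM Q α Γ} {K : ℕ}
    {D : Fin K → Turing.Dir} (i : Fin K) {Z : Fin (K + 1) → Zipper Q Γ} {W : Fin K → List α}
    (h : ∀ j, ∃ n, Sweep M (D j) (orient (D j) (Z j.castSucc)) (W j) n (orient (D j) (Z j.succ)))
    {m : ℕ} (h₀ : Z 0 = blankZipper M.start m) (hlast : (Z (Fin.last K)).state ∈ M.final) :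
    ∃ cs n, CostPath (AllSweeps M (Nat.card Q * Nat.card Γ + 1) D i)
      (fun j => nearStatus (D i) (D j)) cs (W i) n
      (fun j => nearStatus (opposite (D i)) (D j)) := by
  let U : Fin (K + 1) → List (Γ × Option Q) := fun m => (orient (D i) (Z m)).word
  have hp : ∀ j, ∃ ps n, ps.map Prod.fst = U j.castSucc ∧ ps.map Prod.snd = U j.succ ∧
      CostPath (Cell M (D j)) .before (if D j = D i then ps else ps.reverse) (W j) n .after := by
    intro j
    obtain ⟨n, hn⟩ := h j
    obtain ⟨ps, k, h₁, h₂, h₃⟩ := hn.exists_costPath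
    refine ⟨if D j = D i then ps else ps.reverse, k, ?_, ?_, ?_⟩
    · rw [word_orient _ (D i)] at h₁
      split_ifs at h₁ ⊢ with hd
      · exact h₁
      · rw [List.map_reverse, h₁, List.reverse_reverse]
    · rw [word_orient _ (D i)] at h₂
      split_ifs at h₂ ⊢ with hd
      · exact h₂
      · rw [List.map_reverse, h₂, List.reverse_reverse]
    · split_ifs with hd
      · exact h₃
      · simpa using h₃
  choose ps n hfst hsnd hps using hp
  have hlen : ∀ m, (U m).length = (U 0).length := by
    intro m
    induction m using Fin.induction with
    | zero => rfl
    | succ j ih => rw [← ih, ← hfst, ← hsnd, List.length_map, List.length_map]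
  let cs : List (Column Q Γ K) :=
    (List.range (U 0).length).map fun x m => (U m).getD x default
  have hcs : ∀ m, cs.map (fun c => c m) = U m := by
    intro m
    refine List.ext_getElem (by simp [cs, hlen m]) fun x h₁ h₂ => ?_
    simp [cs, List.getElem?_eq_getElem h₂]
  have hpair : ∀ j, cs.map (Column.pair j) = ps j := by
    intro j
    refine List.eq_of_map_fst_eq_of_map_snd_eq ?_ ?_
    · rw [hfst, ← hcs, List.map_map]; rfl
    · rw [hsnd, ← hcs, List.map_map]; rfl
  have hok : ∀ c ∈ cs, Column.Ok M c := by
    intro c hc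
    have hmem : ∀ m, c m ∈ (Z m).word := by
      intro m
      rw [← mem_word_orient (d := D i)]
      change c m ∈ U m
      rw [← hcs]
      exact List.mem_map_of_mem hc
    have h₁ := mem_word (hmem 0)
    have h₂ := mem_word (hmem (Fin.last K))
    rw [h₀] at h₁
    refine ⟨?_, h₁.2, fun q hq => by rwa [h₂.2 q hq]⟩
    rcases h₁.1 with h | h | h
    · exact List.eq_of_mem_replicate h
    · exact h
    · exact List.eq_of_mem_replicate h
  refine ⟨cs, n i, CostPath.of_components (f := Column.pair)
    (R := fun j => SweepCell M _ (D i) (D j)) (T := Cell M (D i)) (P := Column.Ok M) i hok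
    (fun j hj => ?_) ?_⟩
  · rw [sweepCell_path_iff, hpair]
    exact (hps j).toListPath fun _ _ _ _ _ hc => hc.exists_short
  · rw [hpair]
    have := hps i
    rw [if_pos rfl] at this
    convert this using 1 <;> cases D i <;> rfl

end NTM

/-! ### The graph of what is read in one sweep -/

namespace NTM

variable {Q α Γ : Type*}

/-- The nodes of the graph: a boundary between two cells with the status of every sweep, or a visit
of the distinguished sweep to a cell, with the status of every sweep at the far boundary, the
entry that the sweep has to leave in the cell, and the present state and symbol. -/
abbrev SweepNode (Q Γ : Type*) (K : ℕ) :=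
  (Fin K → SweepState Q) ⊕ ((Fin K → SweepState Q) × (Γ × Option Q) × (Q × Γ))

theorem card_sweepNode_le [Finite Q] [Finite Γ] (K : ℕ) :
    Nat.card (Fin K × SweepNode Q Γ K) ≤ K * ((Nat.card Q + 2) ^ K + (Nat.card Q + 2) ^ K *
      ((Nat.card Γ * (Nat.card Q + 1)) * (Nat.card Q * Nat.card Γ))) := by
  rw [Nat.card_prod, Nat.card_sum, Nat.card_prod, Nat.card_prod, Nat.card_prod, Nat.card_prod,
    Nat.card_fun, Finite.card_option, Nat.card_fin]
  have := card_sweepState_le (Q := Q)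
  gcongr

/-- A cell outside the range of a sweep is passed without any step; otherwise it is visited. -/
theorem Cell.pass_or_visit {M : NTM Q α Γ} {d : Turing.Dir} {s s' : SweepState Q}
    {g : (Γ × Option Q) × (Γ × Option Q)} {u : List α} {n : ℕ} (h : Cell M d s g u n s') :
    (u = [] ∧ Cell M d s g [] 0 s') ∨ ∃ p p' v k a, u = v ++ Option.toList a ∧
      Enters s g.1 p ∧ EpsPath M.DwellEdge p v k p' ∧ Leaves M d p' a g.2 s' := by
  cases h with
  | before x => exact .inl ⟨rfl, .before x⟩
  | after x => exact .inl ⟨rfl, .after x⟩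
  | visit h₁ h₂ h₃ => exact .inr ⟨_, _, _, _, _, rfl, h₁, h₂, h₃⟩

variable [Inhabited Γ]

/-- The edges of the graph. The distinguished sweep `i` is tracked step by step, so that every edge
carries at most one letter; the other sweeps pass each cell in one go. -/
inductive SweepEdge (M : NTM Q α Γ) (b : ℕ) {K : ℕ} (D : Fin K → Turing.Dir) :
    Fin K × SweepNode Q Γ K → Option α → Fin K × SweepNode Q Γ K → Prop
  | pass {i : Fin K} {s s' : Fin K → SweepState Q} {c : Column Q Γ K} :
      OtherSweeps M b D i s c s' → Cell M (D i) (s i) (c.pair i) [] 0 (s' i) →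
      SweepEdge M b D (i, .inl s) none (i, .inl s')
  | enter {i : Fin K} {s s' : Fin K → SweepState Q} {c : Column Q Γ K} {p : Q × Γ} :
      OtherSweeps M b D i s c s' → Enters (s i) (c.pair i).1 p →
      SweepEdge M b D (i, .inl s) none (i, .inr (s', (c.pair i).2, p))
  | dwell {i : Fin K} {s : Fin K → SweepState Q} {g : Γ × Option Q} {p p' : Q × Γ}
      {a : Option α} : M.DwellEdge p a p' →
      SweepEdge M b D (i, .inr (s, g, p)) a (i, .inr (s, g, p'))
  | leave {i : Fin K} {s : Fin K → SweepState Q} {g : Γ × Option Q} {p : Q × Γ}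
      {a : Option α} : Leaves M (D i) p a g (s i) →
      SweepEdge M b D (i, .inr (s, g, p)) a (i, .inl s)

/-- A joint passage of all sweeps through the cells is a path in the graph, whose label is what the
distinguished sweep reads. -/
theorem exists_epsPath_of_costPath {M : NTM Q α Γ} {b K : ℕ} {D : Fin K → Turing.Dir}
    {i : Fin K} {cs : List (Column Q Γ K)} {u : List α} {n : ℕ} {s s' : Fin K → SweepState Q}
    (h : CostPath (AllSweeps M b D i) s cs u n s') :
    ∃ n, EpsPath (SweepEdge M b D) (i, .inl s) u n (i, .inl s') := by
  induction h with
  | nil s => exact ⟨0, .nil _⟩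
  | @cons s s' s'' c cs u v m n h _ ih =>
    obtain ⟨k, hk⟩ := ih
    suffices H : ∃ k, EpsPath (SweepEdge M b D) (i, .inl s) u k (i, .inl s') by
      obtain ⟨k', hk'⟩ := H
      exact ⟨_, hk'.append hk⟩
    obtain ⟨ho, hc⟩ := h
    rcases hc.pass_or_visit with ⟨rfl, hc₀⟩ | ⟨p, p', w, k, a, rfl, h₁, h₂, h₃⟩
    · exact ⟨_, EpsPath.single (a := none) (.pass ho hc₀)⟩
    · have hd : ∀ {p p' : Q × Γ} {u : List α} {n : ℕ}, EpsPath M.DwellEdge p u n p' →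
          EpsPath (SweepEdge M b D) (i, .inr (s', (c.pair i).2, p)) u n
            (i, .inr (s', (c.pair i).2, p')) := by
        intro p p' u n h
        induction h with
        | nil p => exact .nil _
        | cons he _ ih => exact .cons (.dwell he) ih
      exact ⟨_, EpsPath.cons (a := none) (.enter ho h₁)
        ((hd h₂).append (EpsPath.single (.leave h₃)))⟩

/-- Paths in the graph that end at a boundary come from joint passages of all sweeps. The second
part concerns paths that start during a visit. -/
theorem exists_costPath_of_epsPath {M : NTM Q α Γ} {b K : ℕ} {D : Fin K → Turing.Dir}
    {i i' : Fin K} {x : SweepNode Q Γ K} {t : Fin K → SweepState Q} {u : List α} {n : ℕ}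
    (h : EpsPath (SweepEdge M b D) (i, x) u n (i', .inl t)) :
    i = i' ∧
    (∀ s, x = .inl s → ∃ cs, ∃ m ≤ n, cs.length ≤ n ∧ CostPath (AllSweeps M b D i) s cs u m t) ∧
    (∀ s g p, x = .inr (s, g, p) → ∃ p' a u₁ u₂ m₁ m₂ cs, u = u₁ ++ Option.toList a ++ u₂ ∧
      EpsPath M.DwellEdge p u₁ m₁ p' ∧ Leaves M (D i) p' a g (s i) ∧ m₁ + 1 + m₂ ≤ n ∧
      cs.length ≤ n ∧ CostPath (AllSweeps M b D i) s cs u₂ m₂ t) := by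
  generalize hX : (i, x) = X at h
  generalize hY : (i', Sum.inl t) = Y at h
  induction h generalizing i x with
  | nil X =>
    subst hX
    obtain ⟨rfl, rfl⟩ := Prod.mk.inj hY
    refine ⟨rfl, fun s hs => ?_, fun s g p hs => (by cases hs)⟩
    cases hs
    exact ⟨[], 0, le_rfl, le_rfl, .nil _⟩
  | cons he _ ih =>
    subst hY
    cases he with
    | pass ho hc =>
      obtain ⟨rfl, rfl⟩ := Prod.mk.inj hX
      obtain ⟨rfl, ih, -⟩ := ih rfl rfl
      obtain ⟨cs, m, hm, hl, hp⟩ := ih _ rfl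
      refine ⟨rfl, fun s hs => ?_, fun s g p hs => (by cases hs)⟩
      cases hs
      exact ⟨_ :: cs, _, by omega, by simp; omega, .cons ⟨ho, hc⟩ hp⟩
    | enter ho hc =>
      obtain ⟨rfl, rfl⟩ := Prod.mk.inj hX
      obtain ⟨rfl, -, ih⟩ := ih rfl rfl
      obtain ⟨p', a, u₁, u₂, m₁, m₂, cs, rfl, h₁, h₂, hm, hl, hp⟩ := ih _ _ _ rfl
      refine ⟨rfl, fun s hs => ?_, fun s g p hs => (by cases hs)⟩
      cases hs
      have hv := Cell.visit hc h₁ h₂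
      exact ⟨_ :: cs, m₁ + 1 + m₂, by omega, by simp; omega,
        by simpa using CostPath.cons ⟨ho, hv⟩ hp⟩
    | dwell hd =>
      obtain ⟨rfl, rfl⟩ := Prod.mk.inj hX
      obtain ⟨rfl, -, ih⟩ := ih rfl rfl
      obtain ⟨p', a, u₁, u₂, m₁, m₂, cs, rfl, h₁, h₂, hm, hl, hp⟩ := ih _ _ _ rfl
      refine ⟨rfl, fun s hs => (by cases hs), fun s g p hs => ?_⟩
      cases hs
      exact ⟨p', a, _, u₂, m₁ + 1, m₂, cs, by simp, .cons hd h₁, h₂, by omega, by omega, hp⟩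
    | leave hl =>
      obtain ⟨rfl, rfl⟩ := Prod.mk.inj hX
      obtain ⟨rfl, ih, -⟩ := ih rfl rfl
      obtain ⟨cs, m, hm, hlen, hp⟩ := ih _ rfl
      refine ⟨rfl, fun s hs => (by cases hs), fun s g p hs => ?_⟩
      cases hs
      exact ⟨_, _, [], _, 0, m, cs, by simp, .nil _, hl, by omega, by omega, hp⟩

end NTM

/-! ### Density is a finite question -/

namespace NTM

/-- A bound on the number of nodes of the graph of `k + 2` sweeps, for `p` states and `g` worktape
symbols. -/
def graphBound (k p g : ℕ) : ℕ :=
  (k + 2) * ((p + 2) ^ (k + 2) + (p + 2) ^ (k + 2) * ((g * (p + 1)) * (p * g)))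

/-- Density of a `k`-reversal-bounded machine shows in the words up to this length. -/
def wordBound (k p g : ℕ) : ℕ :=
  (k + 2) * 2 ^ graphBound k p g

/-- For a dense `k`-reversal-bounded machine, the words up to length `wordBound` are infixes of
inputs of accepting computations of at most this length. -/
def runBound (k p g : ℕ) : ℕ :=
  (k + 2) * (graphBound k p g * (wordBound k p g + 3) * (p * g + 2))

variable {Q α Γ : Type*} [Inhabited Γ]

/-- The word `y` is a factor of what one sweep reads on a path through the graph. -/
def ReadInSweep (M : NTM Q α Γ) (b : ℕ) {K : ℕ} (D : Fin K → Turing.Dir) (y : List α) : Prop :=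
  ∃ x ∈ {x | ∃ i u n, EpsPath (SweepEdge M b D) (i, .inl fun j => nearStatus (D i) (D j)) u n x},
  ∃ z ∈ {z | ∃ i u n, EpsPath (SweepEdge M b D) z u n
    (i, .inl fun j => nearStatus (opposite (D i)) (D j))},
  ∃ n, EpsPath (SweepEdge M b D) x y n z

/-- The direction of each sweep of a computation whose first sweep goes to the right. -/
def sweepDir {K : ℕ} (j : Fin K) : Turing.Dir :=
  opposite^[j] .right

variable [Finite Q] [Finite Γ]

/-- A power of `y` in an accepted word leads to a copy of `y` that is read in one sweep. -/
theorem readInSweep_of_infix {M : NTM Q α Γ} {k : ℕ} (hM : M.IsReversalBounded k) {y w : List α}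
    (hw : w ∈ M.language) (hy : (List.replicate (k + 2) y).flatten <:+: w) :
    ReadInSweep M (Nat.card Q * Nat.card Γ + 1) (sweepDir (K := k + 2)) y := by
  obtain ⟨ms, C, hrun, hacc⟩ := hw
  -- the first sweep goes to the right, which may cost one additional reversal
  have hrev : reversals (some .right :: ms) < k + 2 := by
    have := reversals_cons_le .right ms
    have := hM w ms C hrun hacc
    omega
  obtain ⟨ws, z', hl, hsw, hq, hwf⟩ := hrun.exists_sweeps (blankZipper M.start ms.length) rfl
    (tape_replicate_default _ _ _).symm (by simp [blankZipper]) (by simp [blankZipper]) .right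
    (k + 2) hrev
  rw [hacc.2, List.append_nil] at hwf
  change w = ws.flatten at hwf
  subst hwf
  rw [← hl] at hy
  obtain ⟨v, hv, p, s, hps⟩ := List.exists_infix_of_flatten_replicate_infix y ws
    (by rintro rfl; simp at hl) hy
  obtain ⟨i, hi, rfl⟩ := List.getElem_of_mem hv
  obtain ⟨Z, hZ0, hZK, hZ⟩ := hsw.exists_seq
  obtain ⟨cs, n, hcs⟩ := exists_costPath_of_sweeps (M := M) (D := sweepDir (K := k + 2))
    ⟨i, by omega⟩ (Z := fun m => Z m) (W := fun j => ws[(j : ℕ)]'(by omega))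
    (fun j => by simpa [sweepDir] using hZ j (by omega)) hZ0
    (by rw [Fin.val_last, ← hl, hZK, hq]; exact hacc.1)
  obtain ⟨n, hp⟩ := exists_epsPath_of_costPath hcs
  change EpsPath _ _ ws[i] _ _ at hp
  rw [← hps] at hp
  obtain ⟨z, n₁, n₂, hp, h₃⟩ := hp.split
  obtain ⟨x, n₃, n₄, h₁, h₂⟩ := hp.split
  exact ⟨x, ⟨_, _, _, h₁⟩, z, ⟨_, _, _, h₃⟩, _, h₂⟩

/-- What is read in one sweep is an infix of an accepted word, and a short computation shows it. -/
theorem exists_run_of_readInSweep {M : NTM Q α Γ} {b K : ℕ} {D : Fin K → Turing.Dir} {y : List α}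
    (h : ReadInSweep M b D y) :
    ∃ w ms C, M.Run (M.init w) ms C ∧ M.Accepting C ∧ y <:+: w ∧
      ms.length ≤ K * (Nat.card (Fin K × SweepNode Q Γ K) * (y.length + 3) * (b + 1)) := by
  obtain ⟨x, ⟨i, u, n₁, h₁⟩, z, ⟨i', v, n₃, h₃⟩, n₂, h₂⟩ := h
  obtain ⟨m₁, hm₁, u, h₁⟩ := h₁.shorten_unlabelled
  obtain ⟨m₂, hm₂, h₂⟩ := h₂.shorten
  obtain ⟨m₃, hm₃, v, h₃⟩ := h₃.shorten_unlabelled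
  obtain ⟨rfl, hc, -⟩ := exists_costPath_of_epsPath ((h₁.append h₂).append h₃)
  obtain ⟨cs, m, hm, hl, hp⟩ := hc _ rfl
  obtain ⟨Z, W, N, hs, htape, hstate, hfin, hW, hN⟩ := exists_sweeps_of_costPath hp
  have hK := i.pos
  obtain ⟨ms, hms, hrun⟩ := exists_run_of_sweeps (M := M)
    (fun j => if h : j < K then D ⟨j, h⟩ else .right)
    (fun j => if h : j < K + 1 then Z ⟨j, h⟩ else Z 0)
    (fun j => if h : j < K then W ⟨j, h⟩ else [])
    (fun j => if h : j < K then N ⟨j, h⟩ else 0) K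
    (fun j hj => by
      have h' : j < K + 1 := by omega
      have h'' : j + 1 < K + 1 := by omega
      simp only [dif_pos hj, dif_pos h', dif_pos h'']
      exact hs ⟨j, hj⟩) []
  have h0 : 0 < K + 1 := by omega
  have h1 : K < K + 1 := by omega
  simp only [dif_pos h0, dif_pos h1, List.append_nil] at hrun
  rw [show (Z ⟨0, h0⟩).state = M.start from hstate,
    show (Z ⟨0, h0⟩).tape = default from htape] at hrun
  refine ⟨_, ms, _, hrun, ⟨hfin, rfl⟩, ?_, ?_⟩
  · refine List.IsInfix.trans ?_ (List.infix_flatten_of_mem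
      (List.mem_map.2 ⟨i, List.mem_range.2 i.2, rfl⟩))
    rw [dif_pos i.2, hW]
    exact ⟨u, v, rfl⟩
  · rw [hms]
    refine (Finset.sum_le_card_nsmul _ _ (Nat.card (Fin K × SweepNode Q Γ K) * (y.length + 3) *
      (b + 1)) fun j hj => ?_).trans (by simp)
    rw [dif_pos (Finset.mem_range.1 hj)]
    refine (hN _).trans ?_
    have hsum : m₁ + m₂ + m₃ ≤ Nat.card (Fin K × SweepNode Q Γ K) * (y.length + 3) := by
      rw [show y.length + 3 = 1 + (y.length + 1) + 1 by ring, mul_add, mul_add, mul_one]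
      omega
    calc m + b * cs.length
        ≤ (m₁ + m₂ + m₃) + b * (m₁ + m₂ + m₃) := by gcongr
      _ = (m₁ + m₂ + m₃) * (b + 1) := by ring
      _ ≤ _ := by gcongr

/-- Density of a reversal-bounded machine depends on boundedly many words and computations. -/
theorem isDense_iff {M : NTM Q α Γ} {k : ℕ} (hM : M.IsReversalBounded k) :
    M.language.IsDense ↔ ∀ y : List α, y.length ≤ wordBound k (Nat.card Q) (Nat.card Γ) →
      ∃ w ms C, M.Run (M.init w) ms C ∧ M.Accepting C ∧ y <:+: w ∧
        ms.length ≤ runBound k (Nat.card Q) (Nat.card Γ) := by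
  have hcard := card_sweepNode_le (Q := Q) (Γ := Γ) (k + 2)
  change _ ≤ graphBound k (Nat.card Q) (Nat.card Γ) at hcard
  constructor
  · intro hd y hy
    have hmem : (List.replicate (k + 2) y).flatten ∈ M.language.infixes := by
      rw [hd]; exact Set.mem_univ _
    obtain ⟨w, hw, hyw⟩ := hmem
    obtain ⟨w, ms, C, h₁, h₂, h₃, h₄⟩ :=
      exists_run_of_readInSweep (readInSweep_of_infix hM hw hyw)
    refine ⟨w, ms, C, h₁, h₂, h₃, h₄.trans ?_⟩
    rw [runBound]
    gcongr
  · intro h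
    refine Set.eq_univ_of_forall fun y => ?_
    have : ReadInSweep M (Nat.card Q * Nat.card Γ + 1) (sweepDir (K := k + 2)) y := by
      refine EpsPath.universal_of_short _ _ (fun y hy => ?_) y
      obtain ⟨w, ms, C, h₁, h₂, h₃, -⟩ := h (List.replicate (k + 2) y).flatten (by
        rw [List.length_flatten, List.map_replicate, List.sum_replicate, smul_eq_mul, wordBound]
        gcongr
        exact hy.trans (Nat.pow_le_pow_right (by norm_num) hcard))
      exact readInSweep_of_infix hM ⟨ms, C, h₁, h₂⟩ h₃
    obtain ⟨w, ms, C, h₁, h₂, h₃, -⟩ := exists_run_of_readInSweep this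
    exact ⟨w, ⟨ms, C, h₁, h₂⟩, h₃⟩

end NTM

/-! ### Executing descriptions of machines -/

namespace NTM

variable {Q α Γ : Type*} [Inhabited Γ]

/-- The zipper after a step that enters `q`, writes `y` and moves the head by `m`; where the
stretch ends, the head finds a blank. -/
def Zipper.next (z : Zipper Q Γ) (q : Q) (y : Γ) : Option Turing.Dir → Zipper Q Γ
  | none => ⟨q, z.back, y, z.ahead⟩
  | some .left => ⟨q, z.back.tail, z.back.headI, y :: z.ahead⟩
  | some .right => ⟨q, y :: z.back, z.ahead.headI, z.ahead.tail⟩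

theorem tape_next (z : Zipper Q Γ) (q : Q) (y : Γ) (m : Option Turing.Dir) :
    (z.next q y m).tape = moveHead m (z.tape.write y) := by
  rw [tape_write z q y]
  rcases m with _ | _ | _
  · rfl
  · simp [Zipper.next, moveHead, Zipper.tape, Turing.Tape.mk₂, ← Turing.ListBlank.cons_mk,
      ← Turing.ListBlank.head_mk, ← Turing.ListBlank.tail_mk]
  · simp only [Zipper.next, moveHead, Zipper.tape, Turing.Tape.mk₂, Turing.Tape.move_right_mk',
      ← Turing.ListBlank.cons_mk, Turing.ListBlank.head_cons, Turing.ListBlank.tail_cons,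
      ← Turing.ListBlank.head_mk, ← Turing.ListBlank.tail_mk, Turing.ListBlank.cons_head_tail]

end NTM

namespace NTMCode

/-- A transition in the form in which descriptions list it. -/
abbrev Rule := (ℕ × Option ℕ × ℕ) × (ℕ × ℕ × Option Bool)

/-- A configuration of a described machine without its input: the state, the cells to the left of
the head, the scanned symbol, and the cells to the right of the head. -/
abbrev Conf := ℕ × List ℕ × ℕ × List ℕ

/-- The worktape part of a configuration after a head move. -/
def shift (blank : ℕ) (l : List ℕ) (x : ℕ) (r : List ℕ) (m : Option Bool) :
    List ℕ × ℕ × List ℕ :=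
  Option.casesOn m (l, x, r) fun b =>
    bif b then (x :: l, r.head?.getD blank, r.tail) else (l.tail, l.head?.getD blank, x :: r)

/-- The application of a transition to a configuration, where possible. -/
def applyRule (blank : ℕ) (C : Conf) (t : Rule) : Option Conf :=
  if C.1 = t.1.1 ∧ C.2.2.1 = t.1.2.2 then
    some (t.2.1, shift blank C.2.1 t.2.2.1 C.2.2.2 t.2.2.2)
  else none

/-- The successive application of transitions. -/
def execFrom (blank : ℕ) (C : Option Conf) (ts : List Rule) : Option Conf :=
  ts.foldl (fun C t => C.bind fun C => applyRule blank C t) C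

/-- The letters consumed by a sequence of transitions. -/
def reads (ts : List Rule) : List ℕ :=
  ts.flatMap fun t => t.1.2.1.toList

/-- A transition leads to a state, writes a symbol and reads a letter that are in range. -/
def Valid (t : Rule) (c : NTMCode) : Prop :=
  t.2.1 < c.numStates ∧ t.2.2.1 < c.numSymbols ∧
    (t.1.2.1 = none ∨ t.1.2.1.getD 0 < c.numLetters)

instance (t : Rule) (c : NTMCode) : Decidable (Valid t c) := by
  unfold Valid; infer_instance

/-- The listed transitions that are in range. -/
def rules (c : NTMCode) : List Rule :=
  c.trans.filter fun t => Valid t c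

/-- All words of length at most `n` with letters from a list. -/
def wordsUpTo {β : Type*} (l : List β) (n : ℕ) : List (List β) :=
  Nat.rec [[]] (fun _ ws => [] :: ws.flatMap fun w => l.map fun b => b :: w) n

theorem mem_wordsUpTo {β : Type*} {l : List β} {n : ℕ} {w : List β} :
    w ∈ wordsUpTo l n ↔ w.length ≤ n ∧ ∀ b ∈ w, b ∈ l := by
  induction n generalizing w with
  | zero =>
    change w ∈ [[]] ↔ _
    rw [List.mem_singleton, Nat.le_zero, List.length_eq_zero_iff]
    exact ⟨fun h => ⟨h, by simp [h]⟩, fun h => h.1⟩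
  | succ n ih =>
    change w ∈ [] :: (wordsUpTo l n).flatMap (fun w => l.map fun b => b :: w) ↔ _
    cases w with
    | nil => simp
    | cons a w =>
      simp only [List.mem_cons, reduceCtorEq, List.mem_flatMap, List.mem_map, List.cons.injEq,
        false_or, List.length_cons, Nat.add_le_add_iff_right]
      constructor
      · rintro ⟨w', hw', b, hb, rfl, rfl⟩
        have := ih.1 hw'
        exact ⟨this.1, by rintro b' (rfl | h); exacts [hb, this.2 b' h]⟩
      · rintro ⟨h₁, h₂⟩
        exact ⟨w, ih.2 ⟨h₁, fun b hb => h₂ b (.inr hb)⟩, a, h₂ a (.inl rfl), rfl, rfl⟩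

/-- The transitions `ts` make up an accepting computation on an input with the infix `y`. -/
def Witnesses (ts : List Rule) (c : NTMCode) (y : List ℕ) : Prop :=
  (∃ C, execFrom c.blank (some (c.start, [], c.blank, [])) ts = some C ∧ C.1 ∈ c.final) ∧
    y <:+: reads ts

/-- The criterion for density that can be checked by exhaustive search. -/
def BoundedDense (c : NTMCode) (k : ℕ) : Prop :=
  ∀ y ∈ wordsUpTo (List.range c.numLetters) (NTM.wordBound k c.numStates c.numSymbols),
    ∃ ts ∈ wordsUpTo c.rules (NTM.runBound k c.numStates c.numSymbols), Witnesses ts c y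

section Describes

open NTM

variable {Q α Γ : Type*} {c : NTMCode}
  (eQ : Q ≃ Fin c.numStates) (eα : α ≃ Fin c.numLetters) (eΓ : Γ ≃ Fin c.numSymbols)

/-- The configuration that corresponds to a zipper under numberings of states and symbols. -/
def confOf (z : Zipper Q Γ) : Conf :=
  (eQ z.state, z.back.map fun x => (eΓ x : ℕ), eΓ z.sym, z.ahead.map fun x => (eΓ x : ℕ))

/-- The transition with the given components under numberings of states, letters and symbols. -/
def ruleOf (q : Q) (a : Option α) (x : Γ) (q' : Q) (y : Γ) (m : Option Turing.Dir) : Rule :=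
  (((eQ q : ℕ), a.map (fun b => (eα b : ℕ)), (eΓ x : ℕ)), ((eQ q' : ℕ), (eΓ y : ℕ), m.map dirBit))

theorem ruleOf_mem_rules {q q' : Q} {a : Option α} {x y : Γ} {m : Option Turing.Dir}
    (h : ruleOf eQ eα eΓ q a x q' y m ∈ c.trans) : ruleOf eQ eα eΓ q a x q' y m ∈ c.rules := by
  refine List.mem_filter.2 ⟨h, decide_eq_true ⟨(eQ q').2, (eΓ y).2, ?_⟩⟩
  rcases a with _ | a
  · exact .inl rfl
  · exact .inr (eα a).2

theorem exists_ruleOf {z : Zipper Q Γ} {t : Rule} {C : Conf} (ht : t ∈ c.rules)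
    (hC : applyRule c.blank (confOf eQ eΓ z) t = some C) :
    ∃ a q' y m, t = ruleOf eQ eα eΓ z.state a z.sym q' y m ∧ t ∈ c.trans := by
  obtain ⟨ht, hv⟩ := List.mem_filter.1 ht
  obtain ⟨h₁, h₂, h₃⟩ := of_decide_eq_true hv
  obtain ⟨⟨q, a, x⟩, q', y, m⟩ := t
  have hg : (confOf eQ eΓ z).1 = q ∧ (confOf eQ eΓ z).2.2.1 = x := by
    by_contra hn
    rw [applyRule, if_neg hn] at hC
    cases hC
  obtain ⟨rfl, rfl⟩ := hg
  have hm : ∃ m' : Option Turing.Dir, m = m'.map dirBit := by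
    rcases m with _ | _ | _
    exacts [⟨none, rfl⟩, ⟨some .left, rfl⟩, ⟨some .right, rfl⟩]
  have ha : ∃ a' : Option α, a = a'.map (fun b => (eα b : ℕ)) := by
    rcases a with _ | a
    · exact ⟨none, rfl⟩
    · rcases h₃ with h | h
      · cases h
      · exact ⟨some (eα.symm ⟨a, h⟩), by simp⟩
  obtain ⟨m, rfl⟩ := hm
  obtain ⟨a, rfl⟩ := ha
  refine ⟨a, eQ.symm ⟨q', h₁⟩, eΓ.symm ⟨y, h₂⟩, m, ?_, ht⟩
  simp [ruleOf, confOf]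

variable [Inhabited Γ] {M : NTM Q α Γ}

theorem applyRule_confOf (hblank : (eΓ default : ℕ) = c.blank) (z : Zipper Q Γ) (a : Option α)
    (q' : Q) (y : Γ) (m : Option Turing.Dir) :
    applyRule c.blank (confOf eQ eΓ z) (ruleOf eQ eα eΓ z.state a z.sym q' y m) =
      some (confOf eQ eΓ (z.next q' y m)) := by
  have hh : ∀ l : List Γ, ((l.map fun x => (eΓ x : ℕ)).head?.getD c.blank) = eΓ l.headI := by
    rintro (_ | ⟨x, l⟩)
    · exact hblank.symm
    · rfl
  rcases m with _ | _ | _ <;>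
    simp [applyRule, confOf, ruleOf, shift, Zipper.next, dirBit, ← hh]

/-- A computation of the machine can be executed by transitions of the description. -/
theorem exists_exec_of_run (hblank : (eΓ default : ℕ) = c.blank)
    (htrans : ∀ q a x q' y m, ((q, a, x), (q', y, m)) ∈ M.trans ↔
      ruleOf eQ eα eΓ q a x q' y m ∈ c.trans)
    {C C' : Cfg Q α Γ} {ms : List (Option Turing.Dir)} (h : M.Run C ms C') (z : Zipper Q Γ)
    (hstate : C.state = z.state) (htape : C.tape = z.tape) :
    ∃ ts v, ts.length = ms.length ∧ (∀ t ∈ ts, t ∈ c.rules) ∧ C.input = v ++ C'.input ∧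
      reads ts = v.map (fun a => (eα a : ℕ)) ∧ ∃ z' : Zipper Q Γ, z'.state = C'.state ∧
        execFrom c.blank (some (confOf eQ eΓ z)) ts = some (confOf eQ eΓ z') := by
  induction h generalizing z with
  | refl C => exact ⟨[], [], rfl, by simp, rfl, rfl, z, hstate.symm, rfl⟩
  | @cons C C₁ C' m ms hs hr ih =>
    obtain ⟨ht, w⟩ := hs
    rename_i q q' a y T
    simp only at hstate htape
    subst hstate htape
    rw [Zipper.tape_head] at ht
    obtain ⟨ts, v, hl, hts, hv, hreads, z', hz', hexec⟩ := ih (z.next q' y m)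
      (by rcases m with _ | _ | _ <;> rfl) (tape_next z q' y m).symm
    simp only at hv
    have hmem := ruleOf_mem_rules eQ eα eΓ ((htrans _ _ _ _ _ _).1 ht)
    refine ⟨ruleOf eQ eα eΓ z.state a z.sym q' y m :: ts, a.toList ++ v, by simp [hl],
      List.forall_mem_cons.2 ⟨hmem, hts⟩, by simp [hv], ?_, z', hz', ?_⟩
    · change Option.toList (a.map _) ++ reads ts = _
      rw [hreads, List.map_append]
      cases a <;> rfl
    · rw [← hexec, ← applyRule_confOf eQ eα eΓ hblank z a]
      rfl

/-- Executing transitions of the description from the configuration of a zipper is a computation of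
the machine. -/
theorem exists_run_of_exec (hblank : (eΓ default : ℕ) = c.blank)
    (htrans : ∀ q a x q' y m, ((q, a, x), (q', y, m)) ∈ M.trans ↔
      ruleOf eQ eα eΓ q a x q' y m ∈ c.trans)
    {ts : List Rule} (hts : ∀ t ∈ ts, t ∈ c.rules) {z : Zipper Q Γ} {C : Conf}
    (h : execFrom c.blank (some (confOf eQ eΓ z)) ts = some C) :
    ∃ w ms z', ms.length = ts.length ∧
      M.Run ⟨z.state, w, z.tape⟩ ms ⟨z'.state, [], z'.tape⟩ ∧
      reads ts = w.map (fun a => (eα a : ℕ)) ∧ C = confOf eQ eΓ z' := by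
  induction ts generalizing z with
  | nil => exact ⟨[], [], z, rfl, .refl _, rfl, (Option.some.inj h).symm⟩
  | cons t ts ih =>
    have hne : applyRule c.blank (confOf eQ eΓ z) t ≠ none := by
      intro hn
      have hnone : ∀ ts, execFrom c.blank none ts = none := by
        intro ts
        induction ts with
        | nil => rfl
        | cons t ts ih => exact ih
      change execFrom c.blank (applyRule c.blank (confOf eQ eΓ z) t) ts = some C at h
      rw [hn, hnone] at h
      cases h
    obtain ⟨C₁, hC₁⟩ := Option.ne_none_iff_exists'.1 hne
    obtain ⟨a, q', y, m, rfl, ht⟩ := exists_ruleOf eQ eα eΓ (hts t (by simp)) hC₁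
    change execFrom c.blank (applyRule c.blank (confOf eQ eΓ z) _) ts = some C at h
    rw [applyRule_confOf eQ eα eΓ hblank] at h
    obtain ⟨w, ms, z', hl, hrun, hreads, hC⟩ := ih (fun t ht => hts t (by simp [ht])) h
    refine ⟨a.toList ++ w, m :: ms, z', by simp [hl], .cons ?_ hrun, ?_, hC⟩
    · rw [tape_next]
      have := Step.mk (M := M) (T := z.tape) ((htrans _ _ _ _ _ _).2 ht) w
      rcases m with _ | _ | _ <;> exact this
    · change Option.toList (a.map _) ++ reads ts = _
      rw [hreads, List.map_append]
      cases a <;> rfl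

end Describes

open NTM in
/-- For a described reversal-bounded machine, exhaustive search decides density. -/
theorem boundedDense_iff {Q α Γ : Type*} [Inhabited Γ] {M : NTM Q α Γ} {c : NTMCode} {k : ℕ}
    (hc : c.Describes M) (hM : M.IsReversalBounded k) : BoundedDense c k ↔ M.language.IsDense := by
  obtain ⟨eQ, eα, eΓ, hblank, hstart, hfinal, htrans⟩ := hc
  have := Finite.of_equiv _ eQ.symm
  have := Finite.of_equiv _ eΓ.symm
  have hQ : Nat.card Q = c.numStates := by rw [Nat.card_congr eQ, Nat.card_fin]
  have hΓ : Nat.card Γ = c.numSymbols := by rw [Nat.card_congr eΓ, Nat.card_fin]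
  have hinj : Function.Injective (fun a : α => (eα a : ℕ)) := Fin.val_injective.comp eα.injective
  let z₀ : Zipper Q Γ := ⟨M.start, [], default, []⟩
  have hz₀ : confOf eQ eΓ z₀ = (c.start, [], c.blank, []) := by
    simp [confOf, z₀, hstart, hblank]
  have htape : z₀.tape = default := tape_replicate_default M.start 0 0
  rw [isDense_iff hM, hQ, hΓ]
  constructor
  · intro h y hy
    obtain ⟨ts, hts, ⟨C, hC, hCf⟩, hy⟩ := h (y.map fun a => (eα a : ℕ))
      (mem_wordsUpTo.2 ⟨by simpa using hy, by simp⟩)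
    obtain ⟨hl, hts⟩ := mem_wordsUpTo.1 hts
    rw [← hz₀] at hC
    obtain ⟨w, ms, z', hlen, hrun, hreads, rfl⟩ :=
      exists_run_of_exec eQ eα eΓ hblank htrans hts hC
    rw [htape] at hrun
    refine ⟨w, ms, _, hrun, ⟨(hfinal _).2 hCf, rfl⟩, ?_, by omega⟩
    rw [hreads] at hy
    obtain ⟨l, hl, he⟩ := List.infix_map_iff.1 hy
    rwa [List.map_injective_iff.2 hinj he]
  · intro h y hmem
    obtain ⟨hl, hy⟩ := mem_wordsUpTo.1 hmem
    obtain ⟨y, rfl⟩ : ∃ y' : List α, y = y'.map fun a => (eα a : ℕ) := by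
      clear hl hmem
      induction y with
      | nil => exact ⟨[], rfl⟩
      | cons b y ih =>
        obtain ⟨y', rfl⟩ := ih fun b hb => hy b (by simp [hb])
        exact ⟨eα.symm ⟨b, by simpa using hy b (by simp)⟩ :: y', by simp⟩
    obtain ⟨w, ms, C, hrun, hacc, hyw, hms⟩ := h y (by simpa using hl)
    obtain ⟨ts, v, hlen, hts, hv, hreads, z', hz', hexec⟩ :=
      exists_exec_of_run eQ eα eΓ hblank htrans hrun z₀ rfl htape.symm
    rw [hacc.2, List.append_nil] at hv
    change w = v at hv
    subst hv
    refine ⟨ts, mem_wordsUpTo.2 ⟨by omega, hts⟩, ⟨_, by rw [← hz₀]; exact hexec, ?_⟩, ?_⟩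
    · change (eQ z'.state : ℕ) ∈ c.final
      rw [← hfinal, hz']
      exact hacc.1
    · rw [hreads]
      exact hyw.map _

end NTMCode

/-! ### The search is primitive recursive -/

namespace NTMCode

theorem primrec_equivProd : Primrec equivProd := Primrec.of_equiv

theorem primrec_numStates : Primrec numStates := by
  refine Primrec.of_eq (f := fun c => (equivProd c).1) ?_ fun _ => rfl
  exact Primrec.fst.comp primrec_equivProd

theorem primrec_numLetters : Primrec numLetters := by
  refine Primrec.of_eq (f := fun c => (equivProd c).2.1) ?_ fun _ => rfl
  exact Primrec.fst.comp (Primrec.snd.comp primrec_equivProd)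

theorem primrec_numSymbols : Primrec numSymbols := by
  refine Primrec.of_eq (f := fun c => (equivProd c).2.2.1) ?_ fun _ => rfl
  exact Primrec.fst.comp (Primrec.snd.comp (Primrec.snd.comp primrec_equivProd))

theorem primrec_blank : Primrec blank := by
  refine Primrec.of_eq (f := fun c => (equivProd c).2.2.2.1) ?_ fun _ => rfl
  exact Primrec.fst.comp (Primrec.snd.comp (Primrec.snd.comp (
    Primrec.snd.comp primrec_equivProd)))

theorem primrec_start : Primrec start := by
  refine Primrec.of_eq (f := fun c => (equivProd c).2.2.2.2.1) ?_ fun _ => rfl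
  exact Primrec.fst.comp (Primrec.snd.comp (Primrec.snd.comp (Primrec.snd.comp (
    Primrec.snd.comp primrec_equivProd))))

theorem primrec_final : Primrec final := by
  refine Primrec.of_eq (f := fun c => (equivProd c).2.2.2.2.2.1) ?_ fun _ => rfl
  exact Primrec.fst.comp (Primrec.snd.comp (Primrec.snd.comp (Primrec.snd.comp (
    Primrec.snd.comp (Primrec.snd.comp primrec_equivProd)))))

theorem primrec_trans : Primrec trans := by
  refine Primrec.of_eq (f := fun c => (equivProd c).2.2.2.2.2.2) ?_ fun _ => rfl
  exact Primrec.snd.comp (Primrec.snd.comp (Primrec.snd.comp (Primrec.snd.comp (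
    Primrec.snd.comp (Primrec.snd.comp primrec_equivProd)))))

theorem primrec_shift : Primrec fun p : ℕ × List ℕ × ℕ × List ℕ × Option Bool =>
    shift p.1 p.2.1 p.2.2.1 p.2.2.2.1 p.2.2.2.2 := by
  have hb : Primrec fun p : ℕ × List ℕ × ℕ × List ℕ × Option Bool => p.1 := Primrec.fst
  have hl : Primrec fun p : ℕ × List ℕ × ℕ × List ℕ × Option Bool => p.2.1 :=
    Primrec.fst.comp Primrec.snd
  have hx : Primrec fun p : ℕ × List ℕ × ℕ × List ℕ × Option Bool => p.2.2.1 :=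
    Primrec.fst.comp (Primrec.snd.comp Primrec.snd)
  have hr : Primrec fun p : ℕ × List ℕ × ℕ × List ℕ × Option Bool => p.2.2.2.1 :=
    Primrec.fst.comp (Primrec.snd.comp (Primrec.snd.comp Primrec.snd))
  have hm : Primrec fun p : ℕ × List ℕ × ℕ × List ℕ × Option Bool => p.2.2.2.2 :=
    Primrec.snd.comp (Primrec.snd.comp (Primrec.snd.comp Primrec.snd))
  have hright := (Primrec.list_cons.comp hx hl).pair
    ((Primrec.option_getD.comp (Primrec.list_head?.comp hr) hb).pair (Primrec.list_tail.comp hr))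
  have hleft := (Primrec.list_tail.comp hl).pair
    ((Primrec.option_getD.comp (Primrec.list_head?.comp hl) hb).pair (Primrec.list_cons.comp hx hr))
  exact Primrec.option_casesOn hm (hl.pair (hx.pair hr))
    (Primrec.cond Primrec.snd (hright.comp Primrec.fst) (hleft.comp Primrec.fst)).to₂

theorem primrec_applyRule : Primrec fun p : (ℕ × Conf) × Rule => applyRule p.1.1 p.1.2 p.2 := by
  have hC : Primrec fun p : (ℕ × Conf) × Rule => p.1.2 := Primrec.snd.comp Primrec.fst
  have ht : Primrec fun p : (ℕ × Conf) × Rule => p.2 := Primrec.snd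
  have hb : Primrec fun p : (ℕ × Conf) × Rule => p.1.1 := Primrec.fst.comp Primrec.fst
  have ht₁ := Primrec.fst.comp ht
  have ht₂ := Primrec.snd.comp ht
  refine Primrec.ite ((Primrec.eq.comp (Primrec.fst.comp hC) (Primrec.fst.comp ht₁)).and
    (Primrec.eq.comp (Primrec.fst.comp (Primrec.snd.comp (Primrec.snd.comp hC)))
      (Primrec.snd.comp (Primrec.snd.comp ht₁)))) ?_ (Primrec.const none)
  exact Primrec.option_some.comp ((Primrec.fst.comp ht₂).pair (primrec_shift.comp
    (hb.pair ((Primrec.fst.comp (Primrec.snd.comp hC)).pair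
      ((Primrec.fst.comp (Primrec.snd.comp ht₂)).pair
        ((Primrec.snd.comp (Primrec.snd.comp (Primrec.snd.comp hC))).pair
          (Primrec.snd.comp (Primrec.snd.comp ht₂))))))))

theorem primrec_execFrom : Primrec fun p : (ℕ × Option Conf) × List Rule =>
    execFrom p.1.1 p.1.2 p.2 := by
  have hb : Primrec fun r : (((ℕ × Option Conf) × List Rule) × (Option Conf × Rule)) × Conf =>
      r.1.1.1.1 := Primrec.fst.comp (Primrec.fst.comp (Primrec.fst.comp Primrec.fst))
  have ht : Primrec fun r : (((ℕ × Option Conf) × List Rule) × (Option Conf × Rule)) × Conf =>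
      r.1.2.2 := Primrec.snd.comp (Primrec.snd.comp Primrec.fst)
  have happly := primrec_applyRule.comp ((hb.pair Primrec.snd).pair ht)
  have hbind : Primrec₂ fun (p : (ℕ × Option Conf) × List Rule) (s : Option Conf × Rule) =>
      s.1.bind fun C => applyRule p.1.1 C s.2 :=
    Primrec.option_bind (Primrec.fst.comp Primrec.snd) happly.to₂
  exact Primrec.list_foldl Primrec.snd (Primrec.snd.comp Primrec.fst) hbind

theorem primrec_reads : Primrec reads :=
  Primrec.list_flatMap Primrec.id
    (Primrec.optionToList.comp (Primrec.fst.comp (Primrec.snd.comp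
      (Primrec.fst.comp Primrec.snd)))).to₂

theorem primrecRel_valid : PrimrecRel Valid := by
  have ht : Primrec fun p : Rule × NTMCode => p.1 := Primrec.fst
  have hc : Primrec fun p : Rule × NTMCode => p.2 := Primrec.snd
  have ha := Primrec.fst.comp (Primrec.snd.comp (Primrec.fst.comp ht))
  exact (Primrec.nat_lt.comp (Primrec.fst.comp (Primrec.snd.comp ht))
      (primrec_numStates.comp hc)).and
    ((Primrec.nat_lt.comp (Primrec.fst.comp (Primrec.snd.comp (Primrec.snd.comp ht)))
      (primrec_numSymbols.comp hc)).and
    ((Primrec.eq.comp ha (Primrec.const none)).or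
      (Primrec.nat_lt.comp (Primrec.option_getD.comp ha (Primrec.const 0))
        (primrec_numLetters.comp hc))))

theorem primrec_rules : Primrec rules :=
  primrecRel_valid.listFilter.comp primrec_trans Primrec.id

theorem primrec_wordsUpTo {β : Type*} [Primcodable β] : Primrec₂ (wordsUpTo (β := β)) := by
  refine Primrec.nat_rec (f := fun _ : List β => [[]])
    (g := fun l p => [] :: p.2.flatMap fun w => l.map fun b => b :: w)
    (Primrec.const _) (Primrec₂.mk ?_)
  refine Primrec.list_cons.comp (Primrec.const []) (Primrec.list_flatMap
    (Primrec.snd.comp Primrec.snd) (Primrec₂.mk ?_))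
  exact Primrec.list_map (Primrec.fst.comp Primrec.fst)
    (Primrec.list_cons.comp Primrec.snd (Primrec.snd.comp Primrec.fst)).to₂

theorem primrecRel_infix {β : Type*} [Primcodable β] :
    PrimrecRel fun y w : List β => y <:+: w := by
  classical
  have h : PrimrecRel fun (i : ℕ) (p : List β × List β) =>
      (p.2.drop i).take p.1.length = p.1 :=
    Primrec.eq.comp
      (Primrec.list_take.comp (Primrec.list_length.comp (Primrec.fst.comp Primrec.snd))
        (Primrec.list_drop.comp Primrec.fst (Primrec.snd.comp Primrec.snd)))
      (Primrec.fst.comp Primrec.snd)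
  refine (h.exists_mem_list.comp (Primrec.list_range.comp (Primrec.succ.comp
    (Primrec.list_length.comp Primrec.snd))) Primrec.id).of_eq fun p => ?_
  obtain ⟨y, w⟩ := p
  simp only [List.mem_range, id]
  constructor
  · rintro ⟨i, -, hi⟩
    rw [← hi]
    exact (List.take_prefix _ _).isInfix.trans (List.drop_suffix _ _).isInfix
  · rintro ⟨p, s, rfl⟩
    exact ⟨p.length, by simp, by simp⟩

theorem primrecRel_mem {β : Type*} [Primcodable β] :
    PrimrecRel fun (b : β) (l : List β) => b ∈ l := by
  refine (Primrec.eq.exists_mem_list.comp Primrec.snd Primrec.fst).of_eq fun p => ?_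
  simp

theorem primrecRel_witnesses : PrimrecRel fun (ts : List Rule) (p : NTMCode × List ℕ) =>
    Witnesses ts p.1 p.2 := by
  have hc : Primrec fun q : List Rule × NTMCode × List ℕ => q.2.1 := Primrec.fst.comp Primrec.snd
  have hexec : Primrec fun q : List Rule × NTMCode × List ℕ =>
      execFrom q.2.1.blank (some (q.2.1.start, [], q.2.1.blank, [])) q.1 :=
    primrec_execFrom.comp (((primrec_blank.comp hc).pair (Primrec.option_some.comp
      ((primrec_start.comp hc).pair ((Primrec.const []).pair
        ((primrec_blank.comp hc).pair (Primrec.const [])))))).pair Primrec.fst)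
  -- a successful execution is tested by listing its at most one result
  have hacc : PrimrecRel fun (C : Conf) (c : NTMCode) => C.1 ∈ c.final :=
    primrecRel_mem.comp (Primrec.fst.comp Primrec.fst) (primrec_final.comp Primrec.snd)
  refine PrimrecPred.and ((hacc.exists_mem_list.comp (Primrec.optionToList.comp hexec) hc).of_eq
    fun q => by simp [Option.mem_toList])
    (primrecRel_infix.comp (Primrec.snd.comp Primrec.snd) (primrec_reads.comp Primrec.fst))

theorem primrec_pow : Primrec₂ ((· ^ ·) : ℕ → ℕ → ℕ) :=
  Primrec₂.unpaired'.1 Nat.Primrec.pow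

section Bounds

variable {β : Type*} [Primcodable β] {k p g : β → ℕ}

theorem primrec_graphBound (hk : Primrec k) (hp : Primrec p) (hg : Primrec g) :
    Primrec fun x => NTM.graphBound (k x) (p x) (g x) := by
  have hK := Primrec.nat_add.comp hk (Primrec.const 2)
  have hpow := primrec_pow.comp (Primrec.nat_add.comp hp (Primrec.const 2)) hK
  exact Primrec.nat_mul.comp hK (Primrec.nat_add.comp hpow (Primrec.nat_mul.comp hpow
    (Primrec.nat_mul.comp (Primrec.nat_mul.comp hg (Primrec.nat_add.comp hp (Primrec.const 1)))
      (Primrec.nat_mul.comp hp hg))))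

theorem primrec_wordBound (hk : Primrec k) (hp : Primrec p) (hg : Primrec g) :
    Primrec fun x => NTM.wordBound (k x) (p x) (g x) :=
  Primrec.nat_mul.comp (Primrec.nat_add.comp hk (Primrec.const 2))
    (primrec_pow.comp (Primrec.const 2) (primrec_graphBound hk hp hg))

theorem primrec_runBound (hk : Primrec k) (hp : Primrec p) (hg : Primrec g) :
    Primrec fun x => NTM.runBound (k x) (p x) (g x) :=
  Primrec.nat_mul.comp (Primrec.nat_add.comp hk (Primrec.const 2))
    (Primrec.nat_mul.comp (Primrec.nat_mul.comp (primrec_graphBound hk hp hg)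
      (Primrec.nat_add.comp (primrec_wordBound hk hp hg) (Primrec.const 3)))
      (Primrec.nat_add.comp (Primrec.nat_mul.comp hp hg) (Primrec.const 2)))

end Bounds

theorem primrecPred_boundedDense :
    PrimrecPred fun x : NTMCode × ℕ => BoundedDense x.1 x.2 := by
  have hc : Primrec fun x : NTMCode × ℕ => x.1 := Primrec.fst
  have hk : Primrec fun x : NTMCode × ℕ => x.2 := Primrec.snd
  have hp := primrec_numStates.comp hc
  have hg := primrec_numSymbols.comp hc
  have hin : PrimrecRel fun (y : List ℕ) (x : NTMCode × ℕ) =>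
      ∃ ts ∈ wordsUpTo x.1.rules (NTM.runBound x.2 x.1.numStates x.1.numSymbols),
        Witnesses ts x.1 y :=
    primrecRel_witnesses.exists_mem_list.comp
      ((primrec_wordsUpTo.comp (primrec_rules.comp hc) (primrec_runBound hk hp hg)).comp
        Primrec.snd)
      ((hc.comp Primrec.snd).pair Primrec.fst)
  exact hin.forall_mem_list.comp
    (primrec_wordsUpTo.comp (Primrec.list_range.comp (primrec_numLetters.comp hc))
      (primrec_wordBound hk hp hg)) Primrec.id

end NTMCode

theorem mainTheorem1 :
    ∃ decideDense : NTMCode × ℕ → Bool, Computable decideDense ∧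
      ∀ (Q α Γ : Type*) [Finite Q] [Finite α] [Finite Γ] [Inhabited Γ]
        (M : NTM Q α Γ) (c : NTMCode) (k : ℕ),
        c.Describes M → M.IsReversalBounded k →
          (decideDense (c, k) = true ↔ M.language.IsDense) := by
  obtain ⟨_, h⟩ := NTMCode.primrecPred_boundedDense
  refine ⟨_, h.to_comp, fun Q α Γ _ _ _ _ M c k hc hM => ?_⟩
  rw [decide_eq_true_iff]
  exact NTMCode.boundedDense_iff hc hM
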